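/- **Lemma 2.4.** Let $N\ge 3$, let $m_i>0$ $(0\le i\le N-1)$ be arbitrary masses, $T>0$, and let $q=(q_i):[0,T]\to\mathbb R^{3N}$, $q_i=(x_i,y_i,z_i)$, be continuous and such that on $(0,T)$ it is collision-free, of class $C^2$, and satisfies $$m_i\ddot q_i=\frac{\partial U}{\partial q_i}(q)\quad(0\le i\le N-1),\qquad U(q)=\sum_{i<l}\frac{m_im_l}{|q_i-q_l|}.$$ Assume that for some $j\ne k$ we have $q_j(0)=q_k(0)\neq q_i(0)$ for all $i\notin\{j,k\}$ (other collisions at $t=0$ or at $t=T$ are allowed). Let $q_c=\frac{m_jq_j+m_kq_k}{m_j+m_k}$, let $\phi_j(t)\in[0,\pi]$ be the angle between $q_j(t)-q_c(t)$ and the positive $z$-axis, and assume that $\phi_j^+=\lim_{t\to0^+}\phi_j(t)$ is $0$ or $\pi$. Let $\mathbf I$ be a set of indices containing $j$ and $k$, with $\mathbf I\setminus\{j,k\}=\mathbf I_0\cup\mathbf I_1\ne\emptyset$ and $\mathbf I_0\cap\mathbf I_1=\emptyset$, and put $$\mathcal A_{\mathbf I,T}(q)=\int_0^T\Big(\tfrac12\sum_{i\in\mathbf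 I}m_i|\dot q_i|^2+\sum_{i<l,\ i,l\in\mathbf I}\frac{m_im_l}{|q_i-q_l|}\Big)dt .$$ Suppose $(q_i)_{i\in\mathbf I}$ is $x$-separated by $m_j$ and $m_k$, that is, for all $t\in[0,T]$, $$x_j(T)\le x_j(t)\le x_j(0)=x_k(0)\le x_k(t)\le x_k(T),$$ $x_i(t)\le x_j(T)$ for $i\in\mathbf I_0$, and $x_i(t)\ge x_k(T)$ for $i\in\mathbf I_1$; and suppose $x_j(T)<x_k(T)$. For $\varepsilon>0$ let $\delta_\varepsilon(t)=t(2\varepsilon-t)$ if $t\le\varepsilon$ and $\delta_\varepsilon(t)=\varepsilon^2$ if $t\ge\varepsilon$, and define $$q^\varepsilon_j=q_j-\delta_\varepsilon\mathbf e_1,\quad q^\varepsilon_k=q_k+\delta_\varepsilon\mathbf e_1,\quad q_i^\varepsilon=q_i-\varepsilon^2\mathbf e_1\ (i\in\mathbf I_0),\quad q_i^\varepsilon=q_i+\varepsilon^2\mathbf e_1\ (i\in\mathbf I_1).$$ Then there is $\varepsilon_0>0$ such that for all $\varepsilon\in(0,\varepsilon_0)$ both actions are finite and $\mathcal A_{\mathbf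 I,T}(q^\varepsilon)<\mathcal A_{\mathbf I,T}(q)$. The same holds with $x$, $\mathbf e_1$ replaced by $y$, $\mathbf e_2$: if $(q_i)_{i\in\mathbf I}$ is $y$-separated by $m_j$ and $m_k$ (the same inequalities for the $y$-coordinates) and $y_j(T)<y_k(T)$, then the path $q^\varepsilon$ defined with $\mathbf e_2$ in place of $\mathbf e_1$ has the stated property. -/

import Mathlib

open Set Filter Topology

noncomputable section

namespace NBody

/-- Physical space `ℝ³` with the Euclidean norm; coordinates `0, 1, 2` are `x, y, z`. -/
abbrev Space : Type := EuclideanSpace ℝ (Fin 3)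

/-- The standard basis vectors of space: `e 0`, `e 1`, `e 2` are `e₁`, `e₂`, `e₃`. -/
def e (a : Fin 3) : Space := EuclideanSpace.single a 1

/-- A path of `N` point masses; `q t i` is the position of the `i`-th mass at time `t`.
Only the values for `t ∈ [0, T]` are used below. -/
abbrev Path (N : ℕ) : Type := ℝ → Fin N → Space

/-- The potential function `U_I` of the subsystem `I`: the sum of `mᵢ mₗ / |qᵢ - qₗ|` over the pairs
`i < l` in `I`. For `I` the set of all indices this is `U`. -/
def potential {N : ℕ} (m : Fin N → ℝ) (I : Finset (Fin N)) (x : Fin N → Space) : ℝ :=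
  ∑ p ∈ (I ×ˢ I).filter (fun p => p.1 < p.2), m p.1 * m p.2 / ‖x p.1 - x p.2‖

/-- The kinetic energy `K_I` of the subsystem `I` as a function of the velocities. -/
def kinetic {N : ℕ} (m : Fin N → ℝ) (I : Finset (Fin N)) (v : Fin N → Space) : ℝ :=
  1 / 2 * ∑ i ∈ I, m i * ‖v i‖ ^ 2

/-- The velocities of a path. -/
def velocity {N : ℕ} (q : Path N) (t : ℝ) (i : Fin N) : Space := deriv (fun s => q s i) t

/-- The Lagrangian `L_I = K_I + U_I` along a path. -/
def lagrangian {N : ℕ} (m : Fin N → ℝ) (I : Finset (Fin N)) (q : Path N) (t : ℝ) : ℝ :=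
  kinetic m I (velocity q t) + potential m I (q t)

/-- The (nonnegative) Lagrangian is integrable over `[0, T]`, so the action is a finite number. -/
def HasFiniteAction {N : ℕ} (m : Fin N → ℝ) (I : Finset (Fin N)) (T : ℝ) (q : Path N) : Prop :=
  IntervalIntegrable (lagrangian m I q) MeasureTheory.volume 0 T

/-- The action `∫₀ᵀ L_I dt`. -/
def action {N : ℕ} (m : Fin N → ℝ) (I : Finset (Fin N)) (T : ℝ) (q : Path N) : ℝ :=
  ∫ t in (0 : ℝ)..T, lagrangian m I q t

/-- A solution on `[0, T]` with an isolated binary collision between `j` and `k` at time `0`: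
continuous on `[0, T]`; on `(0, T)` collision-free, of class `C²`, and satisfying
`mᵢ q̈ᵢ = ∂U/∂qᵢ` for every `i`; at time `0` the masses `j` and `k` are at the same point and no other
mass is there. Collisions among the other masses at time `0`, and any collisions at time `T`,
are allowed. -/
structure IsBinaryCollisionSolution {N : ℕ} (m : Fin N → ℝ) (T : ℝ) (j k : Fin N)
    (q : Path N) : Prop where
  continuousOn : ∀ i, ContinuousOn (fun t => q t i) (Icc 0 T)
  collision_free : ∀ t ∈ Ioo 0 T, Function.Injective (q t)
  contDiffOn : ∀ i, ContDiffOn ℝ 2 (fun t => q t i) (Ioo 0 T)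
  newton : ∀ t ∈ Ioo 0 T, ∀ i,
    m i • deriv (deriv (fun s => q s i)) t =
      gradient (fun p : Space => potential m Finset.univ (Function.update (q t) i p)) (q t i)
  collide : q 0 j = q 0 k
  isolated : ∀ i, i ≠ j → i ≠ k → q 0 i ≠ q 0 j

/-- The center of mass of `j` and `k`. -/
def centerOfMass {N : ℕ} (m : Fin N → ℝ) (j k : Fin N) (q : Path N) (t : ℝ) : Space :=
  (m j + m k)⁻¹ • (m j • q t j + m k • q t k)

/-- The spherical coordinate `φ_j ∈ [0, π]` of `q_j - q_c`, i.e. its angle with the positive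
`z`-axis (so `z_j - z_c = r_j cos φ_j`). -/
def polarAngle {N : ℕ} (m : Fin N → ℝ) (j k : Fin N) (q : Path N) (t : ℝ) : ℝ :=
  InnerProductGeometry.angle (q t j - centerOfMass m j k q t) (e 2)

/-- Separation by `j` and `k` in the coordinate `a` (`a = 0`: `x`-separated,
`a = 1`: `y`-separated), with `I₀` on the side of `j` and `I₁` on the side of `k`. -/
structure IsSeparated {N : ℕ} (a : Fin 3) (T : ℝ) (j k : Fin N) (I₀ I₁ : Finset (Fin N))
    (q : Path N) : Prop where
  eq_zero : q 0 j a = q 0 k a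
  left : ∀ t ∈ Icc 0 T, q T j a ≤ q t j a ∧ q t j a ≤ q 0 j a
  right : ∀ t ∈ Icc 0 T, q 0 k a ≤ q t k a ∧ q t k a ≤ q T k a
  outer_left : ∀ t ∈ Icc 0 T, ∀ i ∈ I₀, q t i a ≤ q T j a
  outer_right : ∀ t ∈ Icc 0 T, ∀ i ∈ I₁, q T k a ≤ q t i a

/-- The size of the displacement of the colliding masses: `t (2ε - t)` up to time `ε`,
then `ε²`. -/
def push (ε t : ℝ) : ℝ := if t ≤ ε then t * (2 * ε - t) else ε ^ 2

/-- The deformed path: `j` and `k` are displaced by `push ε t` along `-e a` and `+e a`, the masses in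
`I₀` and `I₁` by `ε²` along `-e a` and `+e a`; masses outside `{j, k} ∪ I₀ ∪ I₁` (which do not enter
the action of the subsystem) are left alone. -/
def deform {N : ℕ} (a : Fin 3) (ε : ℝ) (j k : Fin N) (I₀ I₁ : Finset (Fin N))
    (q : Path N) : Path N := fun t i =>
  if i = j then q t i - push ε t • e a
  else if i = k then q t i + push ε t • e a
  else if i ∈ I₀ then q t i - ε ^ 2 • e a
  else if i ∈ I₁ then q t i + ε ^ 2 • e a
  else q t i

end NBody

end

noncomputable section

namespace NBody

open scoped RealInnerProductSpace
open MeasureTheory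

/-! Let `x` be the separating coordinate, `ρ = q_k - q_j`, `u = m_k x_k - m_j x_j`, and let `δ` be
the push. No distance inside the subsystem decreases under the deformation, so the potential never
grows; the only cost is kinetic, and it arises before time `ε`. There the first order change is `δ'
u'` from the kinetic energy and at most `-2 m_j m_k δ ρ_x / |ρ|³` from the pair `j`, `k`. By
Newton's equations the latter is `δ u''` up to `O(δ)`, since the other masses stay away from the
binary. The two add up to the derivative of `δ u'`, whose integral is `ε² u'(ε)`, and everything
else on `[0, ε]` is `O(ε³)`. Near `T`, an outer mass and the colliding mass on the other side are
moved apart by `2ε²`, which gains at least a fixed multiple `g ε²`. Hence the action changes by at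
most `ε² (u'(ε) + O(ε) - g)`, and it suffices that `limsup u' ≤ 0` at the collision
(`exists_local_bounds`).

This is where the direction of the collision matters: for a limiting direction along the `z`-axis,
`ρ_x` is not merely `o(|ρ|)` but `o(t)` (`tendsto_coord_div`). The reason is that the angular
momentum component `w = v_x ρ_z - ρ_x v_z` is driven only by the bounded tidal force, so `w = O(t
|ρ|)`; as `|ρ| ≥ t`, the derivative `w / ρ_z²` of `ρ_x / ρ_z` is bounded, and `ρ_x = O(t |ρ|)`.
Since the mutual attraction can only lower `u'`, the mean slope of `u` then bounds `u'` from above.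

Finiteness of the action, also with arbitrary collisions at either end, comes from energy
conservation and the convexity of a moment of inertia about the limiting configuration
(`intervalIntegrable_kinetic`). -/

/-! ### Newton's equations in explicit form and conservation of energy. -/

theorem hasFDerivAt_inv_norm {E : Type*} [NormedAddCommGroup E] [InnerProductSpace ℝ E] {p : E}
    (hp : p ≠ 0) :
    HasFDerivAt (fun y : E => ‖y‖⁻¹) (-(‖p‖⁻¹ ^ 3) • innerSL ℝ p) p := by
  have hn : ‖p‖ ≠ 0 := norm_ne_zero_iff.2 hp
  have h1 : HasFDerivAt (fun y : E => ‖y‖ ^ 2) (2 • innerSL ℝ p) p :=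
    (hasStrictFDerivAt_norm_sq p).hasFDerivAt
  have h2 := (h1.sqrt (pow_ne_zero 2 hn))
  simp only [Real.sqrt_sq (norm_nonneg _)] at h2
  have h3 := (hasDerivAt_inv hn).comp_hasFDerivAt p h2
  refine h3.congr_fderiv ?_
  ext y
  simp
  field_simp

theorem HasDerivAt.inv_norm {E : Type*} [NormedAddCommGroup E] [InnerProductSpace ℝ E]
    {f : ℝ → E} {f' : E} {t : ℝ} (hf : HasDerivAt f f' t) (h : f t ≠ 0) :
    HasDerivAt (fun s => ‖f s‖⁻¹) (-(‖f t‖⁻¹ ^ 3) * ⟪f t, f'⟫) t := by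
  have := (hasFDerivAt_inv_norm h).comp_hasDerivAt t hf
  simpa [Function.comp_def] using this

/-- The acceleration of the `i`-th mass caused by all the others. -/
def accel {N : ℕ} (m : Fin N → ℝ) (x : Fin N → Space) (i : Fin N) : Space :=
  ∑ l, (m l * ‖x l - x i‖⁻¹ ^ 3) • (x l - x i)

theorem sum_lt_eq_half {N : ℕ} (f : Fin N → Fin N → ℝ) (hs : ∀ i l, f i l = f l i)
    (h0 : ∀ i, f i i = 0) :
    ∑ p ∈ ((Finset.univ : Finset (Fin N)) ×ˢ Finset.univ).filter (fun p => p.1 < p.2), f p.1 p.2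
      = 1 / 2 * ∑ i, ∑ l, f i l := by
  have h1 : ∑ p ∈ ((Finset.univ : Finset (Fin N)) ×ˢ Finset.univ).filter (fun p => p.1 < p.2),
      f p.1 p.2 = ∑ i, ∑ l, if i < l then f i l else 0 := by
    rw [Finset.sum_filter, Finset.sum_product]
  have h2 : ∑ i, ∑ l, (if i < l then f i l else 0) = ∑ i, ∑ l, if l < i then f i l else 0 := by
    rw [Finset.sum_comm]
    refine Finset.sum_congr rfl fun i _ => Finset.sum_congr rfl fun l _ => ?_
    rw [hs]
  have h3 : ∑ i, ∑ l, f i l = ∑ i, ∑ l, (if i < l then f i l else 0)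
      + ∑ i, ∑ l, (if l < i then f i l else 0) := by
    rw [← Finset.sum_add_distrib]
    refine Finset.sum_congr rfl fun i _ => ?_
    rw [← Finset.sum_add_distrib]
    refine Finset.sum_congr rfl fun l _ => ?_
    rcases lt_trichotomy i l with h | h | h
    · simp [h, h.not_gt]
    · subst h; simp [h0]
    · simp [h, h.not_gt]
  rw [h1, h3, ← h2]; ring

/-- The diagonal terms vanish because `0⁻¹ = 0`, so the symmetric double sum needs no side condition
and its indices can be exchanged freely. -/
theorem potential_univ_eq {N : ℕ} (m : Fin N → ℝ) (x : Fin N → Space) :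
    potential m Finset.univ x = 1 / 2 * ∑ i, ∑ l, m i * m l * ‖x i - x l‖⁻¹ := by
  unfold potential
  simp only [div_eq_mul_inv (_ * _) ‖_‖]
  refine sum_lt_eq_half (fun i l => m i * m l * ‖x i - x l‖⁻¹) (fun i l => ?_) (fun i => ?_)
  · rw [norm_sub_rev]; ring
  · simp

/-- Symmetrization of the virial of the accelerations. -/
theorem sum_inner_accel {N : ℕ} (m : Fin N → ℝ) (x b : Fin N → Space) :
    ∑ i, m i * ⟪b i, accel m x i⟫ =
      -(1 / 2) * ∑ i, ∑ l, m i * m l * (‖x i - x l‖⁻¹ ^ 3 * ⟪b i - b l, x i - x l⟫) := by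
  have h1 : ∑ i, m i * ⟪b i, accel m x i⟫
      = ∑ i, ∑ l, m i * m l * (‖x i - x l‖⁻¹ ^ 3 * ⟪b i, x l - x i⟫) := by
    refine Finset.sum_congr rfl fun i _ => ?_
    rw [accel, inner_sum, Finset.mul_sum]
    refine Finset.sum_congr rfl fun l _ => ?_
    rw [inner_smul_right, norm_sub_rev]; ring
  have h2 : ∑ i, ∑ l, m i * m l * (‖x i - x l‖⁻¹ ^ 3 * ⟪b i, x l - x i⟫)
      = ∑ i, ∑ l, m i * m l * (‖x i - x l‖⁻¹ ^ 3 * ⟪b l, x i - x l⟫) := by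
    rw [Finset.sum_comm]
    refine Finset.sum_congr rfl fun i _ => Finset.sum_congr rfl fun l _ => ?_
    rw [norm_sub_rev]; ring
  have h3 : ∑ i, ∑ l, m i * m l * (‖x i - x l‖⁻¹ ^ 3 * ⟪b i - b l, x i - x l⟫)
      = -∑ i, ∑ l, m i * m l * (‖x i - x l‖⁻¹ ^ 3 * ⟪b i, x l - x i⟫)
        - ∑ i, ∑ l, m i * m l * (‖x i - x l‖⁻¹ ^ 3 * ⟪b l, x i - x l⟫) := by
    rw [← Finset.sum_neg_distrib, ← Finset.sum_sub_distrib]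
    refine Finset.sum_congr rfl fun i _ => ?_
    rw [← Finset.sum_neg_distrib, ← Finset.sum_sub_distrib]
    refine Finset.sum_congr rfl fun l _ => ?_
    rw [inner_sub_left, ← neg_sub (x i) (x l), inner_neg_right]; ring
  rw [h3, ← h2, h1]; ring

/-- Only the ordered pairs containing `i` depend on the moving point. Each unordered pair appears in
both orders with equal contributions, which cancels the factor `1 / 2`. -/
theorem gradient_potential {N : ℕ} (m : Fin N → ℝ) (x : Fin N → Space)
    (hx : Function.Injective x) (i : Fin N) :
    gradient (fun p : Space => potential m Finset.univ (Function.update x i p)) (x i)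
      = m i • accel m x i := by
  apply HasGradientAt.gradient
  rw [hasGradientAt_iff_hasFDerivAt]
  simp only [potential_univ_eq]
  have key : ∀ a l, HasFDerivAt
      (fun p : Space => m a * m l * ‖Function.update x i p a - Function.update x i p l‖⁻¹)
      ((if a = i then innerSL ℝ ((m i * (m l * ‖x l - x i‖⁻¹ ^ 3)) • (x l - x i)) else 0)
        + (if l = i then innerSL ℝ ((m i * (m a * ‖x a - x i‖⁻¹ ^ 3)) • (x a - x i)) else 0))
      (x i) := by
    intro a l
    by_cases ha : a = i
    · subst ha
      by_cases hl : l = a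
      · subst hl
        simpa using hasFDerivAt_const (0 : ℝ) (x l)
      · have hne : x a - x l ≠ 0 := sub_ne_zero.2 fun h => hl (hx h).symm
        have h1 := (hasFDerivAt_inv_norm hne).comp (x a) ((hasFDerivAt_id (x a)).sub_const (x l))
        have h2 := h1.const_mul (m a * m l)
        simp only [Function.update_self, Function.update_of_ne hl, if_neg hl, if_true, add_zero]
        refine h2.congr_fderiv ?_
        ext y
        simp [norm_sub_rev (x l) (x a)]
        ring
    · by_cases hl : l = i
      · subst hl
        have hne : x a - x l ≠ 0 := sub_ne_zero.2 fun h => ha (hx h)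
        have h1 := (hasFDerivAt_inv_norm hne).comp (x l) ((hasFDerivAt_id (x l)).const_sub (x a))
        have h2 := h1.const_mul (m a * m l)
        simp only [Function.update_self, Function.update_of_ne ha, if_neg ha, if_true, zero_add]
        refine h2.congr_fderiv ?_
        ext y
        simp
        ring
      · simp only [Function.update_of_ne hl, Function.update_of_ne ha, if_neg ha, if_neg hl,
          add_zero]
        exact hasFDerivAt_const _ _
  have h := (HasFDerivAt.fun_sum (u := Finset.univ) fun a _ =>
    HasFDerivAt.fun_sum (u := Finset.univ) fun l _ => key a l).const_mul (1 / 2 : ℝ)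
  refine h.congr_fderiv ?_
  have e1 : ∀ g : Fin N → (Space →L[ℝ] ℝ),
      ∑ a, ∑ l, (if a = i then g l else 0) = ∑ l, g l := by
    intro g
    rw [Finset.sum_comm]
    simp
  have e2 : ∀ g : Fin N → (Space →L[ℝ] ℝ),
      ∑ a, ∑ l, (if l = i then g a else 0) = ∑ l, g l := by
    intro g
    simp
  simp only [Finset.sum_add_distrib]
  rw [e1 fun l => innerSL ℝ ((m i * (m l * ‖x l - x i‖⁻¹ ^ 3)) • (x l - x i)),
    e2 fun l => innerSL ℝ ((m i * (m l * ‖x l - x i‖⁻¹ ^ 3)) • (x l - x i)), ← two_smul ℝ,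
    smul_smul]
  simp only [accel, Finset.smul_sum, smul_smul]
  rw [map_sum]
  refine Finset.sum_congr rfl fun l _ => ?_
  norm_num
  rfl

namespace IsBinaryCollisionSolution

variable {N : ℕ} {m : Fin N → ℝ} {T : ℝ} {j k : Fin N} {q : Path N}

theorem hasDerivAt (hq : IsBinaryCollisionSolution m T j k q) {t : ℝ} (ht : t ∈ Ioo 0 T)
    (i : Fin N) : HasDerivAt (fun s => q s i) (velocity q t i) t :=
  (((hq.contDiffOn i).contDiffAt (isOpen_Ioo.mem_nhds ht)).differentiableAt
    (by norm_num)).hasDerivAt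

theorem hasDerivAt_velocity (hq : IsBinaryCollisionSolution m T j k q) (hm : ∀ i, 0 < m i)
    {t : ℝ} (ht : t ∈ Ioo 0 T) (i : Fin N) :
    HasDerivAt (fun s => velocity q s i) (accel m (q t) i) t := by
  have h1 : ContDiffOn ℝ 1 (deriv fun s => q s i) (Ioo 0 T) :=
    ((contDiffOn_succ_iff_deriv_of_isOpen (n := 1) isOpen_Ioo).1
      (by simpa [one_add_one_eq_two] using hq.contDiffOn i)).2.2
  have h2 : HasDerivAt (deriv fun s => q s i) (deriv (deriv fun s => q s i) t) t :=
    ((h1.contDiffAt (isOpen_Ioo.mem_nhds ht)).differentiableAt (by norm_num)).hasDerivAt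
  have h3 := hq.newton t ht i
  rw [gradient_potential m (q t) (hq.collision_free t ht) i] at h3
  rw [← smul_right_injective Space (hm i).ne' h3]
  exact h2

theorem sub_ne_zero (hq : IsBinaryCollisionSolution m T j k q) {t : ℝ} (ht : t ∈ Ioo 0 T)
    {i l : Fin N} (h : i ≠ l) : q t i - q t l ≠ 0 :=
  _root_.sub_ne_zero.2 fun h' => h (hq.collision_free t ht h')

theorem hasDerivAt_kinetic (hq : IsBinaryCollisionSolution m T j k q) (hm : ∀ i, 0 < m i)
    {t : ℝ} (ht : t ∈ Ioo 0 T) :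
    HasDerivAt (fun s => kinetic m Finset.univ (velocity q s))
      (∑ i, m i * ⟪velocity q t i, accel m (q t) i⟫) t := by
  unfold kinetic
  have h := (HasDerivAt.fun_sum (u := Finset.univ) fun i _ =>
    ((hq.hasDerivAt_velocity hm ht i).norm_sq).const_mul (m i)).const_mul (1 / 2 : ℝ)
  refine h.congr_deriv ?_
  rw [Finset.mul_sum]
  refine Finset.sum_congr rfl fun i _ => ?_
  ring

theorem hasDerivAt_potential (hq : IsBinaryCollisionSolution m T j k q)
    {t : ℝ} (ht : t ∈ Ioo 0 T) :
    HasDerivAt (fun s => potential m Finset.univ (q s))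
      (∑ i, m i * ⟪velocity q t i, accel m (q t) i⟫) t := by
  simp only [potential_univ_eq]
  have key : ∀ i l, HasDerivAt (fun s => m i * m l * ‖q s i - q s l‖⁻¹)
      (-(m i * m l * (‖q t i - q t l‖⁻¹ ^ 3 *
        ⟪velocity q t i - velocity q t l, q t i - q t l⟫))) t := by
    intro i l
    by_cases h : i = l
    · subst h; simpa using hasDerivAt_const t (0 : ℝ)
    · refine ((HasDerivAt.inv_norm ((hq.hasDerivAt ht i).sub (hq.hasDerivAt ht l))
        (hq.sub_ne_zero ht h)).const_mul (m i * m l)).congr_deriv ?_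
      rw [real_inner_comm]
      simp only [Pi.sub_apply]
      ring
  have h := (HasDerivAt.fun_sum (u := Finset.univ) fun i _ =>
    HasDerivAt.fun_sum (u := Finset.univ) fun l _ => key i l).const_mul (1 / 2 : ℝ)
  refine h.congr_deriv ?_
  rw [sum_inner_accel]
  simp only [Finset.sum_neg_distrib]
  ring

theorem exists_energy (hq : IsBinaryCollisionSolution m T j k q) (hm : ∀ i, 0 < m i) :
    ∃ h : ℝ, ∀ t ∈ Ioo 0 T,
      kinetic m Finset.univ (velocity q t) - potential m Finset.univ (q t) = h := by
  have hd : ∀ t ∈ Ioo 0 T, HasDerivAt (fun s => kinetic m Finset.univ (velocity q s)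
      - potential m Finset.univ (q s)) 0 t := fun t ht =>
    ((hq.hasDerivAt_kinetic hm ht).sub (hq.hasDerivAt_potential ht)).congr_deriv (sub_self _)
  exact isOpen_Ioo.exists_is_const_of_deriv_eq_zero isPreconnected_Ioo
    (fun t ht => (hd t ht).differentiableAt.differentiableWithinAt) fun t ht => (hd t ht).deriv

end IsBinaryCollisionSolution

/-! ### Finite action up to collisions at both ends. -/

/-- The function `J₁ + C t` is increasing. As `J` starts at its minimum `0`, the mean value theorem
gives times arbitrarily close to `0` with `J₁ ≥ 0`, so `J₁ + C t` is nonnegative throughout. Its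
value at `τ` therefore bounds the integral of `K` over `[s, τ]` uniformly in `s`. -/
theorem integrableOn_of_le_second_deriv {J J₁ J₂ K : ℝ → ℝ} {τ C : ℝ} (hτ : 0 < τ) (hC : 0 ≤ C)
    (hJ : ContinuousOn J (Icc 0 τ)) (hJ0 : J 0 = 0) (hJn : ∀ t ∈ Ioc 0 τ, 0 ≤ J t)
    (h1 : ∀ t ∈ Ioc 0 τ, HasDerivAt J (J₁ t) t) (h2 : ∀ t ∈ Ioc 0 τ, HasDerivAt J₁ (J₂ t) t)
    (hK0 : ∀ t ∈ Ioc 0 τ, 0 ≤ K t) (hK : ∀ t ∈ Ioc 0 τ, K t - C ≤ J₂ t)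
    (hKc : ContinuousOn K (Ioc 0 τ)) : IntervalIntegrable K volume 0 τ := by
  set g : ℝ → ℝ := fun t => J₁ t + C * t with hg
  have hgd : ∀ t ∈ Ioc 0 τ, HasDerivAt g (J₂ t + C) t := fun t ht =>
    ((h2 t ht).fun_add ((hasDerivAt_id t).const_mul C)).congr_deriv (by simp)
  have hmono : MonotoneOn g (Ioc 0 τ) := by
    refine monotoneOn_of_deriv_nonneg (convex_Ioc 0 τ)
      (fun t ht => (hgd t ht).continuousAt.continuousWithinAt)
      (fun t ht => (hgd t (interior_subset ht)).differentiableAt.differentiableWithinAt)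
      fun t ht => ?_
    rw [(hgd t (interior_subset ht)).deriv]
    linarith [hK0 t (interior_subset ht), hK t (interior_subset ht)]
  have hpos : ∀ t ∈ Ioc 0 τ, 0 ≤ g t := by
    intro t ht
    obtain ⟨ξ, hξ, hξ'⟩ := exists_hasDerivAt_eq_slope J J₁ ht.1
      (hJ.mono (Icc_subset_Icc_right ht.2)) fun s hs => h1 s ⟨hs.1, hs.2.le.trans ht.2⟩
    have h : 0 ≤ J₁ ξ := by
      rw [hξ', hJ0]
      exact div_nonneg (by linarith [hJn t ht]) (by linarith [ht.1])
    have h3 := hmono ⟨hξ.1, hξ.2.le.trans ht.2⟩ ht hξ.2.le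
    have : 0 ≤ C * ξ := mul_nonneg hC hξ.1.le
    simp only [hg] at h3 ⊢
    linarith
  rw [intervalIntegrable_iff_integrableOn_Ioc_of_le hτ.le]
  have hlim : Tendsto (fun n : ℕ => τ / ((n : ℝ) + 1)) atTop (𝓝 0) :=
    tendsto_const_div_atTop_nhds_zero_nat τ |>.comp (tendsto_add_atTop_nat 1) |>.congr fun n => by
      simp
  have hmem : ∀ n : ℕ, τ / ((n : ℝ) + 1) ∈ Ioc 0 τ := fun n =>
    ⟨by positivity, div_le_self hτ.le (by linarith [n.cast_nonneg (α := ℝ)])⟩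
  have hint : ∀ n : ℕ, IntegrableOn K (Icc (τ / ((n : ℝ) + 1)) τ) := fun n =>
    (hKc.mono fun t ht => ⟨(hmem n).1.trans_le ht.1, ht.2⟩).integrableOn_Icc
  refine integrableOn_Ioc_of_intervalIntegral_norm_bounded_left (I := g τ) (l := atTop)
    (fun n => (hint n).mono_set Ioc_subset_Icc_self) hlim (Eventually.of_forall fun n => ?_)
  have hsub : ∀ t ∈ Icc (τ / ((n : ℝ) + 1)) τ, t ∈ Ioc 0 τ :=
    fun t ht => ⟨(hmem n).1.trans_le ht.1, ht.2⟩
  have h4 := intervalIntegral.integral_le_sub_of_hasDeriv_right_of_le (hmem n).2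
    (fun t ht => (hgd t (hsub t ht)).continuousAt.continuousWithinAt)
    (fun t ht => (hgd t (hsub t (Ioo_subset_Icc_self ht))).hasDerivWithinAt) (hint n)
    fun t ht => by linarith [hK t (hsub t (Ioo_subset_Icc_self ht))]
  rw [intervalIntegral.integral_of_le (hmem n).2] at h4
  rw [setIntegral_congr_fun measurableSet_Ioc (g := K) fun t ht => by
    rw [Real.norm_of_nonneg (hK0 t (hsub t (Ioc_subset_Icc_self ht)))]]
  linarith [hpos _ (hmem n)]

/-- The moment of inertia about a fixed reference configuration `p`. -/
def inertia {N : ℕ} (m : Fin N → ℝ) (p x : Fin N → Space) : ℝ := ∑ i, m i * ‖x i - p i‖ ^ 2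

theorem kinetic_nonneg {N : ℕ} {m : Fin N → ℝ} (hm : ∀ i, 0 < m i) (I : Finset (Fin N))
    (v : Fin N → Space) : 0 ≤ kinetic m I v :=
  mul_nonneg (by norm_num) (Finset.sum_nonneg fun i _ => mul_nonneg (hm i).le (sq_nonneg _))

theorem potential_nonneg {N : ℕ} {m : Fin N → ℝ} (hm : ∀ i, 0 < m i) (I : Finset (Fin N))
    (x : Fin N → Space) : 0 ≤ potential m I x :=
  Finset.sum_nonneg fun p _ =>
    div_nonneg (mul_nonneg (hm p.1).le (hm p.2).le) (norm_nonneg _)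

/-- For `p = 0` this is Euler's identity for a function homogeneous of degree `-1`. The reference
configuration adds one term per pair, nonnegative by `h`. -/
theorem neg_potential_le_sum_inner_accel {N : ℕ} {m : Fin N → ℝ} (hm : ∀ i, 0 < m i)
    (x p : Fin N → Space) (h : ∀ i l, 0 ≤ ⟪p i - p l, x i - x l⟫) :
    -potential m Finset.univ x ≤ ∑ i, m i * ⟪x i - p i, accel m x i⟫ := by
  rw [sum_inner_accel, potential_univ_eq, neg_mul_eq_neg_mul]
  refine mul_le_mul_of_nonpos_left ?_ (by norm_num)
  refine Finset.sum_le_sum fun i _ => Finset.sum_le_sum fun l _ => ?_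
  refine mul_le_mul_of_nonneg_left ?_ (mul_nonneg (hm i).le (hm l).le)
  have e : x i - p i - (x l - p l) = (x i - x l) - (p i - p l) := by abel
  rw [e, inner_sub_left, real_inner_self_eq_norm_sq]
  have h0 : 0 ≤ ‖x i - x l‖⁻¹ ^ 3 * ⟪p i - p l, x i - x l⟫ := mul_nonneg (by positivity) (h i l)
  have h1 : ‖x i - x l‖⁻¹ ^ 3 * ‖x i - x l‖ ^ 2 = ‖x i - x l‖⁻¹ := by
    rcases eq_or_ne ‖x i - x l‖ 0 with h | h
    · simp [h]
    · field_simp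
  rw [mul_sub, h1]
  linarith

namespace IsBinaryCollisionSolution

variable {N : ℕ} {m : Fin N → ℝ} {T : ℝ} {j k : Fin N} {q : Path N}

theorem hasDerivAt_inertia (hq : IsBinaryCollisionSolution m T j k q) (p : Fin N → Space)
    {t : ℝ} (ht : t ∈ Ioo 0 T) :
    HasDerivAt (fun s => inertia m p (q s)) (2 * ∑ i, m i * ⟪q t i - p i, velocity q t i⟫) t := by
  unfold inertia
  refine (HasDerivAt.fun_sum (u := Finset.univ) fun i _ =>
    (((hq.hasDerivAt ht i).sub_const (p i)).norm_sq).const_mul (m i)).congr_deriv ?_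
  rw [Finset.mul_sum]
  exact Finset.sum_congr rfl fun i _ => by ring

theorem hasDerivAt_deriv_inertia (hq : IsBinaryCollisionSolution m T j k q) (hm : ∀ i, 0 < m i)
    (p : Fin N → Space) {t : ℝ} (ht : t ∈ Ioo 0 T) :
    HasDerivAt (fun s => 2 * ∑ i, m i * ⟪q s i - p i, velocity q s i⟫)
      (4 * kinetic m Finset.univ (velocity q t)
        + 2 * ∑ i, m i * ⟪q t i - p i, accel m (q t) i⟫) t := by
  refine ((HasDerivAt.fun_sum (u := Finset.univ) fun i _ =>
    ((((hq.hasDerivAt ht i).sub_const (p i)).inner ℝ (hq.hasDerivAt_velocity hm ht i))).const_mul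
      (m i)).const_mul 2).congr_deriv ?_
  simp only [kinetic, real_inner_self_eq_norm_sq, mul_add, Finset.sum_add_distrib]
  ring

/-- Pairs in collision at time `s` give exactly `0`; the others give a quantity with a positive
limit. Taking the configuration at the end time as reference thus handles every pattern of
collisions there. -/
theorem eventually_inner_nonneg (hq : IsBinaryCollisionSolution m T j k q) {s : ℝ}
    (hs : s ∈ Icc 0 T) :
    ∀ᶠ t in 𝓝[Icc 0 T] s, ∀ i l, 0 ≤ ⟪q s i - q s l, q t i - q t l⟫ := by
  rw [eventually_all]; intro i
  rw [eventually_all]; intro l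
  rcases eq_or_ne (q s i - q s l) 0 with h | h
  · simp [h]
  · have h1 : Tendsto (fun t => ⟪q s i - q s l, q t i - q t l⟫) (𝓝[Icc 0 T] s)
        (𝓝 ⟪q s i - q s l, q s i - q s l⟫) :=
      tendsto_const_nhds.inner ((hq.continuousOn i s hs).sub (hq.continuousOn l s hs))
    exact (h1.eventually_const_lt (real_inner_self_pos.2 h)).mono fun t ht => le_of_lt ht

theorem continuousOn_inertia (hq : IsBinaryCollisionSolution m T j k q) (p : Fin N → Space) :
    ContinuousOn (fun s => inertia m p (q s)) (Icc 0 T) :=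
  continuousOn_finsetSum _ fun i _ =>
    continuousOn_const.mul (((hq.continuousOn i).sub continuousOn_const).norm.pow 2)

theorem continuousOn_kinetic (hq : IsBinaryCollisionSolution m T j k q) (hm : ∀ i, 0 < m i) :
    ContinuousOn (fun t => kinetic m Finset.univ (velocity q t)) (Ioo 0 T) :=
  fun _ ht => (hq.hasDerivAt_kinetic hm ht).continuousAt.continuousWithinAt

/-- With energy `h`, the Lagrange-Jacobi bound reads `4K - 2U = 2K + 2h ≥ K - 2|h|`. -/
theorem exists_kinetic_le (hq : IsBinaryCollisionSolution m T j k q) (hm : ∀ i, 0 < m i) :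
    ∃ C : ℝ, 0 ≤ C ∧ ∀ t ∈ Ioo 0 T, ∀ p : Fin N → Space,
      (∀ i l, 0 ≤ ⟪p i - p l, q t i - q t l⟫) →
      kinetic m Finset.univ (velocity q t) - C ≤ 4 * kinetic m Finset.univ (velocity q t)
        + 2 * ∑ i, m i * ⟪q t i - p i, accel m (q t) i⟫ := by
  obtain ⟨h, hh⟩ := hq.exists_energy hm
  refine ⟨2 * |h|, by positivity, fun t ht p hp => ?_⟩
  have h1 := neg_potential_le_sum_inner_accel hm (q t) p hp
  have h2 := kinetic_nonneg hm Finset.univ (velocity q t)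
  linarith [hh t ht, neg_abs_le h]

theorem intervalIntegrable_kinetic (hq : IsBinaryCollisionSolution m T j k q)
    (hm : ∀ i, 0 < m i) (hT : 0 < T) :
    IntervalIntegrable (fun t => kinetic m Finset.univ (velocity q t)) volume 0 T := by
  obtain ⟨C, hC, hKC⟩ := hq.exists_kinetic_le hm
  have inertia_nonneg : ∀ p x, 0 ≤ inertia m p x := fun p x =>
    Finset.sum_nonneg fun i _ => mul_nonneg (hm i).le (sq_nonneg _)
  have inertia_self : ∀ p, inertia m p p = 0 := fun p => by simp [inertia]
  obtain ⟨τ, hτ, hτT, left⟩ : ∃ τ, 0 < τ ∧ τ < T ∧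
      IntervalIntegrable (fun t => kinetic m Finset.univ (velocity q t)) volume 0 τ := by
    have h := hq.eventually_inner_nonneg (left_mem_Icc.2 hT.le)
    rw [nhdsWithin_Icc_eq_nhdsGE hT] at h
    obtain ⟨τ', hτ', hsub⟩ := mem_nhdsGE_iff_exists_Icc_subset.1 h
    have hτ'0 : (0 : ℝ) < τ' := hτ'
    refine ⟨min τ' (T / 2), by positivity, by linarith [min_le_right τ' (T / 2)], ?_⟩
    have hmem : ∀ t ∈ Ioc 0 (min τ' (T / 2)), t ∈ Ioo 0 T := fun t ht =>
      ⟨ht.1, by linarith [ht.2, min_le_right τ' (T / 2)]⟩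
    refine integrableOn_of_le_second_deriv (by positivity) hC
      ((hq.continuousOn_inertia (q 0)).mono fun t ht =>
        ⟨ht.1, by linarith [ht.2, min_le_right τ' (T / 2)]⟩)
      (inertia_self _) (fun t _ => inertia_nonneg _ _)
      (fun t ht => hq.hasDerivAt_inertia (q 0) (hmem t ht))
      (fun t ht => hq.hasDerivAt_deriv_inertia hm (q 0) (hmem t ht))
      (fun t _ => kinetic_nonneg hm _ _)
      (fun t ht => hKC t (hmem t ht) (q 0) (hsub ⟨ht.1.le, ht.2.trans (min_le_left _ _)⟩))
      ((hq.continuousOn_kinetic hm).mono hmem)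
  obtain ⟨σ, hσ, hσT, right⟩ : ∃ σ, 0 < σ ∧ σ < T ∧
      IntervalIntegrable (fun t => kinetic m Finset.univ (velocity q t)) volume σ T := by
    have h := hq.eventually_inner_nonneg (right_mem_Icc.2 hT.le)
    rw [nhdsWithin_Icc_eq_nhdsLE hT] at h
    obtain ⟨σ', hσ', hsub⟩ := mem_nhdsLE_iff_exists_Icc_subset.1 h
    have hσ'T : σ' < T := hσ'
    set τ := min (T - σ') (T / 2) with hτdef
    have hτ : 0 < τ := lt_min (by linarith) (by linarith)
    have hτ1 : τ ≤ T - σ' := min_le_left _ _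
    have hτ2 : τ ≤ T / 2 := min_le_right _ _
    -- The end `T` reduces to a collision at `0` by reversing time: first derivatives change sign,
    -- second derivatives do not.
    refine ⟨T - τ, by linarith, by linarith, ?_⟩
    have hmem : ∀ t ∈ Ioc 0 τ, T - t ∈ Ioo 0 T := fun t ht =>
      ⟨by linarith [ht.2], by linarith [ht.1]⟩
    have hrev : ∀ t, HasDerivAt (fun s => T - s) (-1) t := fun t => by
      simpa using (hasDerivAt_id t).const_sub T
    have key : IntervalIntegrable (fun t => kinetic m Finset.univ (velocity q (T - t)))
        volume 0 τ := by
      refine integrableOn_of_le_second_deriv (J := fun t => inertia m (q T) (q (T - t)))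
        (J₁ := fun t => -(2 * ∑ i, m i * ⟪q (T - t) i - q T i, velocity q (T - t) i⟫))
        hτ hC
        ((hq.continuousOn_inertia (q T)).comp (by fun_prop) fun t ht =>
          ⟨by linarith [ht.2], by linarith [ht.1]⟩)
        (by simp [inertia_self]) (fun t _ => inertia_nonneg _ _)
        (fun t ht => ?_) (fun t ht => ?_)
        (fun t _ => kinetic_nonneg hm _ _)
        (fun t ht => hKC _ (hmem t ht) (q T) (hsub ⟨by linarith [ht.2], by linarith [ht.1]⟩))
        ((hq.continuousOn_kinetic hm).comp (by fun_prop) hmem)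
      · exact ((hq.hasDerivAt_inertia (q T) (hmem t ht)).comp t (hrev t)).congr_deriv (by ring)
      · exact ((hq.hasDerivAt_deriv_inertia hm (q T) (hmem t ht)).comp t (hrev t)).fun_neg.congr_deriv
          (by ring)
    simpa using (key.comp_sub_left T).symm
  refine left.trans (IntervalIntegrable.trans ?_ right)
  refine ((hq.continuousOn_kinetic hm).mono fun t ht => ?_).intervalIntegrable
  exact ⟨(lt_min hτ hσ).trans_le ht.1, ht.2.trans_lt (max_lt hτT hσT)⟩

theorem intervalIntegrable_potential (hq : IsBinaryCollisionSolution m T j k q)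
    (hm : ∀ i, 0 < m i) (hT : 0 < T) :
    IntervalIntegrable (fun t => potential m Finset.univ (q t)) volume 0 T := by
  obtain ⟨h, hh⟩ := hq.exists_energy hm
  have h1 := (hq.intervalIntegrable_kinetic hm hT).sub (intervalIntegrable_const (c := h))
  rw [intervalIntegrable_iff_integrableOn_Ioo_of_le hT.le] at h1 ⊢
  refine h1.congr_fun (fun t ht => ?_) measurableSet_Ioo
  beta_reduce
  linarith [hh t ht]

end IsBinaryCollisionSolution

/-! ### Asymptotics of a perturbed Kepler motion at collision. -/

theorem nonneg_of_tendsto_of_deriv_nonneg {f f' : ℝ → ℝ} {σ : ℝ}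
    (hd : ∀ t ∈ Ioc 0 σ, HasDerivAt f (f' t) t) (hf' : ∀ t ∈ Ioc 0 σ, 0 ≤ f' t)
    (h0 : Tendsto f (𝓝[>] 0) (𝓝 0)) : ∀ t ∈ Ioc 0 σ, 0 ≤ f t := by
  have hmono : MonotoneOn f (Ioc 0 σ) := by
    refine monotoneOn_of_deriv_nonneg (convex_Ioc 0 σ)
      (fun t ht => (hd t ht).continuousAt.continuousWithinAt)
      (fun t ht => (hd t (interior_subset ht)).differentiableAt.differentiableWithinAt)
      fun t ht => ?_
    rw [(hd t (interior_subset ht)).deriv]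
    exact hf' t (interior_subset ht)
  intro t ht
  refine le_of_tendsto h0 ?_
  filter_upwards [Ioo_mem_nhdsGT ht.1] with s hs
  exact hmono ⟨hs.1, hs.2.le.trans ht.2⟩ ht hs.2.le

theorem abs_le_of_tendsto_of_abs_deriv_le {f f' : ℝ → ℝ} {σ C : ℝ}
    (hd : ∀ t ∈ Ioc 0 σ, HasDerivAt f (f' t) t) (hf' : ∀ t ∈ Ioc 0 σ, |f' t| ≤ C)
    (h0 : Tendsto f (𝓝[>] 0) (𝓝 0)) : ∀ t ∈ Ioc 0 σ, |f t| ≤ C * t := by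
  intro t ht
  have hid : Tendsto (fun s : ℝ => C * s) (𝓝[>] 0) (𝓝 0) := by
    have : Tendsto (fun s : ℝ => C * s) (𝓝 0) (𝓝 (C * 0)) := tendsto_id.const_mul C
    simpa using this.mono_left nhdsWithin_le_nhds
  have hC : ∀ s : ℝ, HasDerivAt (fun s => C * s) C s := fun s => by
    simpa using (hasDerivAt_id s).const_mul C
  have h1 := nonneg_of_tendsto_of_deriv_nonneg (fun s hs => (hC s).fun_sub (hd s hs))
    (fun s hs => sub_nonneg.2 ((abs_le.1 (hf' s hs)).2)) (by simpa using hid.sub h0) t ht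
  have h2 := nonneg_of_tendsto_of_deriv_nonneg (fun s hs => (hC s).fun_add (hd s hs))
    (fun s hs => by linarith [(abs_le.1 (hf' s hs)).1]) (by simpa using hid.add h0) t ht
  exact abs_le.2 ⟨by linarith, by linarith⟩

/-- A perturbed Kepler motion `ρ'' = -M ρ / |ρ|³ + F` with bounded `F` that starts in a collision at
time `0` and has finite action. -/
structure IsPerturbedCollision (M C τ : ℝ) (ρ v F : ℝ → Space) : Prop where
  mass_pos : 0 < M
  time_pos : 0 < τ
  hasDerivAt : ∀ t ∈ Ioc 0 τ, HasDerivAt ρ (v t) t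
  hasDerivAt_velocity : ∀ t ∈ Ioc 0 τ, HasDerivAt v (-((M * ‖ρ t‖⁻¹ ^ 3) • ρ t) + F t) t
  norm_force_le : ∀ t ∈ Ioc 0 τ, ‖F t‖ ≤ C
  ne_zero : ∀ t ∈ Ioc 0 τ, ρ t ≠ 0
  tendsto_zero : Tendsto ρ (𝓝[>] 0) (𝓝 0)
  integrable : IntervalIntegrable (fun t => ‖v t‖ ^ 2) volume 0 τ

namespace IsPerturbedCollision

variable {M C τ : ℝ} {ρ v F : ℝ → Space}

theorem const_nonneg (h : IsPerturbedCollision M C τ ρ v F) : 0 ≤ C :=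
  (norm_nonneg _).trans (h.norm_force_le τ (right_mem_Ioc.2 h.time_pos))

theorem norm_pow_mul {p : Space} (hp : p ≠ 0) : ‖p‖⁻¹ ^ 3 * ‖p‖ ^ 2 = ‖p‖⁻¹ := by
  have := norm_ne_zero_iff.2 hp
  field_simp

/-- The Kepler energy changes only through the work `⟪v, F⟫` of the perturbation, at most `C (1 +
|v|²)`, which is integrable because the action is finite. -/
theorem exists_abs_energy_le (h : IsPerturbedCollision M C τ ρ v F) :
    ∃ D, 0 ≤ D ∧ ∀ t ∈ Ioc 0 τ, |1 / 2 * ‖v t‖ ^ 2 - M * ‖ρ t‖⁻¹| ≤ D := by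
  set E : ℝ → ℝ := fun t => 1 / 2 * ‖v t‖ ^ 2 - M * ‖ρ t‖⁻¹ with hE
  have hd : ∀ t ∈ Ioc 0 τ, HasDerivAt E ⟪v t, F t⟫ t := by
    intro t ht
    refine ((((h.hasDerivAt_velocity t ht).norm_sq).const_mul (1 / 2)).fun_sub
      ((HasDerivAt.inv_norm (h.hasDerivAt t ht) (h.ne_zero t ht)).const_mul M)).congr_deriv ?_
    rw [inner_add_right, inner_neg_right, inner_smul_right, real_inner_comm (ρ t)]
    ring
  set φ : ℝ → ℝ := fun t => C * (1 + ‖v t‖ ^ 2) with hφ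
  have hφi : IntervalIntegrable φ volume 0 τ :=
    ((intervalIntegrable_const (c := (1 : ℝ))).add h.integrable).const_mul C
  have hφ0 : ∀ t, 0 ≤ φ t := fun t => mul_nonneg h.const_nonneg (by positivity)
  have hb : ∀ t ∈ Ioc 0 τ, |⟪v t, F t⟫| ≤ φ t := by
    intro t ht
    refine (abs_real_inner_le_norm _ _).trans ?_
    have h1 := h.norm_force_le t ht
    have h2 : ‖v t‖ ≤ 1 + ‖v t‖ ^ 2 := by nlinarith [sq_nonneg (‖v t‖ - 1)]
    calc ‖v t‖ * ‖F t‖ ≤ (1 + ‖v t‖ ^ 2) * C :=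
          mul_le_mul h2 h1 (norm_nonneg _) (by positivity)
      _ = φ t := mul_comm _ _
  refine ⟨|E τ| + ∫ t in (0 : ℝ)..τ, φ t, ?_, fun t ht => ?_⟩
  · exact add_nonneg (abs_nonneg _) (intervalIntegral.integral_nonneg h.time_pos.le fun t _ => hφ0 t)
  have hsub : Icc t τ ⊆ Ioc 0 τ := fun s hs => ⟨ht.1.trans_le hs.1, hs.2⟩
  have hint : IntegrableOn φ (Icc t τ) := by
    rw [intervalIntegrable_iff_integrableOn_Ioc_of_le h.time_pos.le] at hφi
    exact hφi.mono_set hsub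
  have hle : ∫ s in t..τ, φ s ≤ ∫ s in (0 : ℝ)..τ, φ s := by
    refine intervalIntegral.integral_mono_interval ht.1.le ht.2 le_rfl
      (Eventually.of_forall hφ0) hφi
  have hc : ContinuousOn E (Icc t τ) := fun s hs =>
    (hd s (hsub hs)).continuousAt.continuousWithinAt
  have h1 := intervalIntegral.sub_le_integral_of_hasDeriv_right_of_le ht.2 hc
    (fun s hs => (hd s (hsub (Ioo_subset_Icc_self hs))).hasDerivWithinAt) hint
    fun s hs => (abs_le.1 (hb s (hsub (Ioo_subset_Icc_self hs)))).2
  have h2 := intervalIntegral.sub_le_integral_of_hasDeriv_right_of_le ht.2 hc.neg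
    (fun s hs => (hd s (hsub (Ioo_subset_Icc_self hs))).neg.hasDerivWithinAt) hint
    fun s hs => by linarith [(abs_le.1 (hb s (hsub (Ioo_subset_Icc_self hs)))).1]
  simp only [Pi.neg_apply] at h2
  change |E t| ≤ _
  refine abs_le.2 ⟨?_, ?_⟩ <;> linarith [neg_abs_le (E τ), le_abs_self (E τ)]

theorem tendsto_norm (h : IsPerturbedCollision M C τ ρ v F) :
    Tendsto (fun t => ‖ρ t‖) (𝓝[>] 0) (𝓝 0) := by
  simpa using h.tendsto_zero.norm

theorem tendsto_norm_mul_norm (h : IsPerturbedCollision M C τ ρ v F) :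
    Tendsto (fun t => ‖ρ t‖ * ‖v t‖) (𝓝[>] 0) (𝓝 0) := by
  obtain ⟨D, hD, hE⟩ := h.exists_abs_energy_le
  have h1 : Tendsto (fun t => √(2 * D * ‖ρ t‖ ^ 2 + 2 * M * ‖ρ t‖)) (𝓝[>] 0) (𝓝 0) := by
    have := (((h.tendsto_norm.pow 2).const_mul (2 * D)).add
      (h.tendsto_norm.const_mul (2 * M))).sqrt
    simpa using this
  refine tendsto_of_tendsto_of_tendsto_of_le_of_le' tendsto_const_nhds h1
    (Eventually.of_forall fun t => by positivity) ?_
  filter_upwards [Ioc_mem_nhdsGT h.time_pos] with t ht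
  refine Real.le_sqrt_of_sq_le ?_
  have hr := norm_pos_iff.2 (h.ne_zero t ht)
  have h2 : ‖v t‖ ^ 2 ≤ 2 * D + 2 * M * ‖ρ t‖⁻¹ := by linarith [(abs_le.1 (hE t ht)).2]
  calc (‖ρ t‖ * ‖v t‖) ^ 2 = ‖ρ t‖ ^ 2 * ‖v t‖ ^ 2 := by ring
    _ ≤ ‖ρ t‖ ^ 2 * (2 * D + 2 * M * ‖ρ t‖⁻¹) := by gcongr
    _ = _ := by field_simp

/-- Near the collision the distance is increasing and at least `t`. -/
theorem exists_monotoneOn_norm (h : IsPerturbedCollision M C τ ρ v F) :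
    ∃ σ, 0 < σ ∧ σ ≤ τ ∧ MonotoneOn (fun t => ‖ρ t‖) (Ioc 0 σ) ∧ ∀ t ∈ Ioc 0 σ, t ≤ ‖ρ t‖ := by
  obtain ⟨D, hD, hE⟩ := h.exists_abs_energy_le
  have hC := h.const_nonneg
  have hM := h.mass_pos
  -- The second threshold makes `M / |ρ| ≥ 1 + 2D + C`, so that `(|ρ|²)'' = 4E + 2M / |ρ| + 2⟪ρ, F⟫
  -- ≥ 2`; two integrations from `0` give `|ρ|² ≥ t²`.
  have hev : ∀ᶠ t in 𝓝[>] (0 : ℝ), ‖ρ t‖ ≤ 1 ∧ ‖ρ t‖ ≤ M / (1 + 2 * D + C) :=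
    (h.tendsto_norm.eventually_le_const one_pos).and
      (h.tendsto_norm.eventually_le_const (by positivity))
  obtain ⟨σ', hσ', hsub⟩ := mem_nhdsGT_iff_exists_Ioc_subset.1 hev
  have hσ'0 : (0 : ℝ) < σ' := hσ'
  have hmem : ∀ t ∈ Ioc 0 (min σ' τ), t ∈ Ioc 0 τ := fun t ht => ⟨ht.1, ht.2.trans (min_le_right _ _)⟩
  have hS1 : ∀ t ∈ Ioc 0 (min σ' τ), HasDerivAt (fun s => ‖ρ s‖ ^ 2) (2 * ⟪ρ t, v t⟫) t :=
    fun t ht => (h.hasDerivAt t (hmem t ht)).norm_sq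
  have hS2 : ∀ t ∈ Ioc 0 (min σ' τ), HasDerivAt (fun s => 2 * ⟪ρ s, v s⟫)
      (4 * (1 / 2 * ‖v t‖ ^ 2 - M * ‖ρ t‖⁻¹) + 2 * M * ‖ρ t‖⁻¹ + 2 * ⟪ρ t, F t⟫) t := by
    intro t ht
    refine (((h.hasDerivAt t (hmem t ht)).inner ℝ
      (h.hasDerivAt_velocity t (hmem t ht))).const_mul 2).congr_deriv ?_
    rw [inner_add_right, inner_neg_right, inner_smul_right, real_inner_self_eq_norm_sq,
      real_inner_self_eq_norm_sq, mul_assoc M, norm_pow_mul (h.ne_zero t (hmem t ht))]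
    ring
  have hS2' : ∀ t ∈ Ioc 0 (min σ' τ),
      2 ≤ 4 * (1 / 2 * ‖v t‖ ^ 2 - M * ‖ρ t‖⁻¹) + 2 * M * ‖ρ t‖⁻¹ + 2 * ⟪ρ t, F t⟫ := by
    intro t ht
    obtain ⟨hr1, hr2⟩ := hsub ⟨ht.1, ht.2.trans (min_le_left _ _)⟩
    have hr := norm_pos_iff.2 (h.ne_zero t (hmem t ht))
    have h1 : 1 + 2 * D + C ≤ M * ‖ρ t‖⁻¹ := by
      rw [← div_eq_mul_inv, le_div_iff₀ hr]
      rwa [le_div_iff₀ (by positivity), mul_comm] at hr2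
    have h2 : |⟪ρ t, F t⟫| ≤ C := by
      refine (abs_real_inner_le_norm _ _).trans ?_
      calc ‖ρ t‖ * ‖F t‖ ≤ 1 * C :=
            mul_le_mul hr1 (h.norm_force_le t (hmem t ht)) (norm_nonneg _) zero_le_one
        _ = C := one_mul C
    linarith [(abs_le.1 (hE t (hmem t ht))).1, (abs_le.1 h2).1]
  have hS1lim : Tendsto (fun t => 2 * ⟪ρ t, v t⟫) (𝓝[>] 0) (𝓝 0) := by
    have : Tendsto (fun t => ⟪ρ t, v t⟫) (𝓝[>] 0) (𝓝 0) :=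
      squeeze_zero_norm (fun t => norm_inner_le_norm _ _) h.tendsto_norm_mul_norm
    simpa using this.const_mul 2
  have hid : ∀ c : ℝ, Tendsto (fun s : ℝ => c * s) (𝓝[>] 0) (𝓝 0) := fun c => by
    have : Tendsto (fun s : ℝ => c * s) (𝓝 0) (𝓝 (c * 0)) := tendsto_id.const_mul c
    simpa using this.mono_left nhdsWithin_le_nhds
  have hS1pos := nonneg_of_tendsto_of_deriv_nonneg
    (fun t ht => (hS2 t ht).fun_sub (((hasDerivAt_id t).const_mul 2).congr_deriv (mul_one _)))
    (fun t ht => by linarith [hS2' t ht]) (by simpa using hS1lim.sub (hid 2))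
  have hSpos := nonneg_of_tendsto_of_deriv_nonneg
    (fun t ht => (hS1 t ht).fun_sub (hasDerivAt_pow 2 t))
    (fun t ht => by have := hS1pos t ht; simp at this ⊢; linarith)
    (by
      have h1 := (h.tendsto_norm.pow 2).sub ((hid 1).pow 2)
      simpa using h1)
  refine ⟨min σ' τ, lt_min hσ'0 h.time_pos, min_le_right _ _, ?_, fun t ht => ?_⟩
  · have hmono : MonotoneOn (fun s => ‖ρ s‖ ^ 2) (Ioc 0 (min σ' τ)) := by
      refine monotoneOn_of_deriv_nonneg (convex_Ioc _ _)
        (fun t ht => (hS1 t ht).continuousAt.continuousWithinAt)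
        (fun t ht => (hS1 t (interior_subset ht)).differentiableAt.differentiableWithinAt)
        fun t ht => ?_
      rw [(hS1 t (interior_subset ht)).deriv]
      have h1 := hS1pos t (interior_subset ht)
      have h2 := (interior_subset ht).1
      simp only [id] at h1
      linarith
    intro s hs t ht hst
    exact (sq_le_sq₀ (norm_nonneg _) (norm_nonneg _)).1 (hmono hs ht hst)
  · have h1 := hSpos t ht
    exact (sq_le_sq₀ ht.1.le (norm_nonneg _)).1 (by linarith)

theorem sq_add_sq_le (p : Space) {a : Fin 3} (ha : a ≠ 2) : p a ^ 2 + p 2 ^ 2 ≤ ‖p‖ ^ 2 := by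
  rw [EuclideanSpace.norm_sq_eq, Fin.sum_univ_three]
  simp only [Real.norm_eq_abs, sq_abs]
  fin_cases a
  · simp; positivity
  · simp; positivity
  · exact absurd rfl ha

theorem tendsto_coord_div_norm (h : IsPerturbedCollision M C τ ρ v F) {c : ℝ} (hc : c ^ 2 = 1)
    (hz : Tendsto (fun t => ρ t 2 / ‖ρ t‖) (𝓝[>] 0) (𝓝 c)) {a : Fin 3} (ha : a ≠ 2) :
    Tendsto (fun t => ρ t a / ‖ρ t‖) (𝓝[>] 0) (𝓝 0) := by
  have h1 : Tendsto (fun t => √(1 - (ρ t 2 / ‖ρ t‖) ^ 2)) (𝓝[>] 0) (𝓝 0) := by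
    have := ((hz.pow 2).const_sub 1).sqrt
    simpa [hc] using this
  refine squeeze_zero_norm' ?_ h1
  filter_upwards [Ioc_mem_nhdsGT h.time_pos] with t ht
  refine Real.le_sqrt_of_sq_le ?_
  have hr := norm_pos_iff.2 (h.ne_zero t ht)
  rw [Real.norm_eq_abs, sq_abs, div_pow, div_pow, le_sub_iff_add_le, ← add_div,
    div_le_one (by positivity)]
  exact sq_add_sq_le _ ha

theorem hasDerivAt_coord {f : ℝ → Space} {f' : Space} {t : ℝ} (hf : HasDerivAt f f' t)
    (a : Fin 3) : HasDerivAt (fun s => f s a) (f' a) t :=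
  ((EuclideanSpace.proj a : Space →L[ℝ] ℝ).hasFDerivAt.comp_hasDerivAt t hf)

theorem abs_coord_le (p : Space) (a : Fin 3) : |p a| ≤ ‖p‖ := PiLp.norm_apply_le p a

/-- If the collision is along the `z`-axis, then the other coordinates are `o(t)`. -/
theorem tendsto_coord_div (h : IsPerturbedCollision M C τ ρ v F) {c : ℝ} (hc : c ^ 2 = 1)
    (hz : Tendsto (fun t => ρ t 2 / ‖ρ t‖) (𝓝[>] 0) (𝓝 c)) {a : Fin 3} (ha : a ≠ 2) :
    Tendsto (fun t => ρ t a / t) (𝓝[>] 0) (𝓝 0) := by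
  obtain ⟨σ₁, hσ₁, hσ₁τ, hmono, hlow⟩ := h.exists_monotoneOn_norm
  have hC := h.const_nonneg
  -- The square tends to `1`; the threshold `1 / 4` keeps `|ρ_z| ≥ |ρ| / 2`, so dividing by `ρ_z` is
  -- safe.
  have hz' : ∀ᶠ t in 𝓝[>] (0 : ℝ), 1 / 4 ≤ (ρ t 2 / ‖ρ t‖) ^ 2 :=
    (hz.pow 2).eventually_const_le (by rw [hc]; norm_num)
  obtain ⟨σ₂, hσ₂, hsub⟩ := mem_nhdsGT_iff_exists_Ioc_subset.1 hz'
  have hσ₂0 : (0 : ℝ) < σ₂ := hσ₂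
  set σ := min σ₁ σ₂ with hσ
  have hσ0 : 0 < σ := lt_min hσ₁ hσ₂0
  have hm1 : ∀ t ∈ Ioc 0 σ, t ∈ Ioc 0 σ₁ := fun t ht => ⟨ht.1, ht.2.trans (min_le_left _ _)⟩
  have hmτ : ∀ t ∈ Ioc 0 σ, t ∈ Ioc 0 τ := fun t ht => ⟨ht.1, (hm1 t ht).2.trans hσ₁τ⟩
  have hzr : ∀ t ∈ Ioc 0 σ, ‖ρ t‖ ^ 2 ≤ 4 * ρ t 2 ^ 2 := by
    intro t ht
    have h1 : 1 / 4 ≤ (ρ t 2 / ‖ρ t‖) ^ 2 := hsub ⟨ht.1, ht.2.trans (min_le_right _ _)⟩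
    have hr := norm_pos_iff.2 (h.ne_zero t (hmτ t ht))
    rw [div_pow, le_div_iff₀ (by positivity)] at h1
    linarith
  have hz0 : ∀ t ∈ Ioc 0 σ, ρ t 2 ≠ 0 := by
    intro t ht h0
    have h1 := hzr t ht
    have hr := norm_pos_iff.2 (h.ne_zero t (hmτ t ht))
    rw [h0] at h1
    nlinarith
  -- An angular momentum component: the central force drops out of its derivative, and `w / ρ_z²` is
  -- the derivative of `ρ_a / ρ_z`.
  set w : ℝ → ℝ := fun t => v t a * ρ t 2 - ρ t a * v t 2 with hw
  have hwd : ∀ t ∈ Ioc 0 σ, HasDerivAt w (F t a * ρ t 2 - ρ t a * F t 2) t := by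
    intro t ht
    have d1 := hasDerivAt_coord (h.hasDerivAt t (hmτ t ht))
    have d2 := hasDerivAt_coord (h.hasDerivAt_velocity t (hmτ t ht))
    refine (((d2 a).fun_mul (d1 2)).fun_sub ((d1 a).fun_mul (d2 2))).congr_deriv ?_
    simp
    ring
  have hw0 : Tendsto w (𝓝[>] 0) (𝓝 0) := by
    refine squeeze_zero_norm (fun t => ?_) (by simpa using h.tendsto_norm_mul_norm.const_mul 2)
    calc ‖w t‖ ≤ |v t a * ρ t 2| + |ρ t a * v t 2| := by
          rw [Real.norm_eq_abs]; exact abs_sub _ _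
      _ ≤ ‖v t‖ * ‖ρ t‖ + ‖ρ t‖ * ‖v t‖ := by
          rw [abs_mul, abs_mul]
          gcongr <;> exact abs_coord_le _ _
      _ = 2 * (‖ρ t‖ * ‖v t‖) := by ring
  -- Monotonicity of `|ρ|` lets the torque at all earlier times be bounded through `|ρ t|`; a crude
  -- uniform bound would lose the factor `|ρ t|` needed below.
  have hwb : ∀ t ∈ Ioc 0 σ, |w t| ≤ 2 * C * ‖ρ t‖ * t := by
    intro t ht
    have hs : ∀ s ∈ Ioc 0 t, s ∈ Ioc 0 σ := fun s hs => ⟨hs.1, hs.2.trans ht.2⟩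
    refine abs_le_of_tendsto_of_abs_deriv_le (fun s hs' => hwd s (hs s hs')) (fun s hs' => ?_) hw0 t
      ⟨ht.1, le_rfl⟩
    have hF := h.norm_force_le s (hmτ s (hs s hs'))
    calc |F s a * ρ s 2 - ρ s a * F s 2| ≤ |F s a * ρ s 2| + |ρ s a * F s 2| := abs_sub _ _
      _ ≤ C * ‖ρ t‖ + ‖ρ t‖ * C := by
          rw [abs_mul, abs_mul]
          have hm : ‖ρ s‖ ≤ ‖ρ t‖ := hmono (hm1 s (hs s hs')) (hm1 t ht) hs'.2
          gcongr
          · exact (abs_coord_le _ _).trans hF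
          · exact (abs_coord_le _ _).trans hm
          · exact (abs_coord_le _ _).trans hm
          · exact (abs_coord_le _ _).trans hF
      _ = 2 * C * ‖ρ t‖ := by ring
  have hratio : ∀ t ∈ Ioc 0 σ, |ρ t a / ρ t 2| ≤ 8 * C * t := by
    refine abs_le_of_tendsto_of_abs_deriv_le (f' := fun t => w t / ρ t 2 ^ 2) (fun t ht => ?_)
      (fun t ht => ?_) ?_
    · have d1 := hasDerivAt_coord (h.hasDerivAt t (hmτ t ht))
      exact (d1 a).fun_div (d1 2) (hz0 t ht)
    · have hz2 : 0 < ρ t 2 ^ 2 := by have := hz0 t ht; positivity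
      rw [abs_div, abs_of_pos hz2, div_le_iff₀ hz2]
      have hr := norm_nonneg (ρ t)
      calc |w t| ≤ 2 * C * ‖ρ t‖ * t := hwb t ht
        _ ≤ 2 * C * ‖ρ t‖ * ‖ρ t‖ := by gcongr; exact hlow t (hm1 t ht)
        _ = 2 * C * ‖ρ t‖ ^ 2 := by ring
        _ ≤ 2 * C * (4 * ρ t 2 ^ 2) := by gcongr; exact hzr t ht
        _ = _ := by ring
    · have h1 := (h.tendsto_coord_div_norm hc hz ha).div hz (by rintro rfl; norm_num at hc)
      rw [zero_div] at h1
      refine h1.congr' ?_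
      filter_upwards [Ioc_mem_nhdsGT hσ0] with t ht
      have hr := norm_pos_iff.2 (h.ne_zero t (hmτ t ht))
      have := hz0 t ht
      rw [Pi.div_apply]
      field_simp
  refine squeeze_zero_norm' (a := fun t => 8 * C * ‖ρ t‖) ?_
    (by simpa using h.tendsto_norm.const_mul (8 * C))
  filter_upwards [Ioc_mem_nhdsGT hσ0] with t ht
  have h1 := hratio t ht
  have hz2 : 0 < |ρ t 2| := abs_pos.2 (hz0 t ht)
  rw [abs_div, div_le_iff₀ hz2] at h1
  have ht0 := ht.1
  rw [Real.norm_eq_abs, abs_div, abs_of_pos ht.1, div_le_iff₀ ht.1]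
  calc |ρ t a| ≤ 8 * C * t * |ρ t 2| := h1
    _ ≤ 8 * C * t * ‖ρ t‖ := by gcongr; exact abs_coord_le _ _
    _ = _ := by ring

end IsPerturbedCollision

/-! ### The colliding pair as a perturbed Kepler motion. -/

/-- The acceleration of the `i`-th mass caused by the masses other than `j` and `k`. -/
def extAccel {N : ℕ} (m : Fin N → ℝ) (j k : Fin N) (x : Fin N → Space) (i : Fin N) : Space :=
  ∑ l ∈ Finset.univ \ {j, k}, (m l * ‖x l - x i‖⁻¹ ^ 3) • (x l - x i)

theorem accel_left {N : ℕ} (m : Fin N → ℝ) {j k : Fin N} (hjk : j ≠ k) (x : Fin N → Space) :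
    accel m x j = (m k * ‖x k - x j‖⁻¹ ^ 3) • (x k - x j) + extAccel m j k x j := by
  unfold accel extAccel
  rw [← Finset.sum_sdiff (Finset.subset_univ {j, k}), Finset.sum_pair hjk]
  simp [add_comm]

theorem accel_right {N : ℕ} (m : Fin N → ℝ) {j k : Fin N} (hjk : j ≠ k) (x : Fin N → Space) :
    accel m x k = -((m j * ‖x k - x j‖⁻¹ ^ 3) • (x k - x j)) + extAccel m j k x k := by
  unfold accel extAccel
  rw [← Finset.sum_sdiff (Finset.subset_univ {j, k}), Finset.sum_pair hjk, ← smul_neg, neg_sub]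
  simp [add_comm, norm_sub_rev (x k) (x j)]

theorem measurable_velocity {N : ℕ} (q : Path N) (i : Fin N) :
    Measurable fun t => velocity q t i := measurable_deriv _

namespace IsBinaryCollisionSolution

variable {N : ℕ} {m : Fin N → ℝ} {T : ℝ} {j k : Fin N} {q : Path N}

theorem exists_norm_extAccel_le (hq : IsBinaryCollisionSolution m T j k q) (hT : 0 < T)
    {i : Fin N} (hi : i = j ∨ i = k) :
    ∃ C, 0 ≤ C ∧ ∀ᶠ t in 𝓝[>] 0, ‖extAccel m j k (q t) i‖ ≤ C := by
  refine ⟨‖extAccel m j k (q 0) i‖ + 1, by positivity, ?_⟩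
  have hlim : Tendsto (fun t => extAccel m j k (q t) i) (𝓝[Icc 0 T] 0)
      (𝓝 (extAccel m j k (q 0) i)) := by
    refine tendsto_finsetSum _ fun l hl => ?_
    simp only [Finset.mem_sdiff, Finset.mem_univ, Finset.mem_insert, Finset.mem_singleton,
      true_and, not_or] at hl
    have hne : q 0 l - q 0 i ≠ 0 := by
      refine _root_.sub_ne_zero.2 ?_
      rcases hi with rfl | rfl
      · exact hq.isolated l hl.1 hl.2
      · rw [← hq.collide]; exact hq.isolated l hl.1 hl.2
    have h0 : (0 : ℝ) ∈ Icc 0 T := left_mem_Icc.2 hT.le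
    have h1 := (hq.continuousOn l 0 h0).tendsto.sub (hq.continuousOn i 0 h0).tendsto
    exact (((h1.norm.inv₀ (norm_ne_zero_iff.2 hne)).pow 3).const_mul (m l)).smul h1
  have h2 := hlim.norm.eventually_le_const (lt_add_one ‖extAccel m j k (q 0) i‖)
  rw [nhdsWithin_Icc_eq_nhdsGE hT] at h2
  exact h2.filter_mono (nhdsWithin_mono _ Ioi_subset_Ici_self)

theorem norm_velocity_sq_le (hm : ∀ i, 0 < m i) (v : Fin N → Space) (i : Fin N) :
    ‖v i‖ ^ 2 ≤ 2 / m i * kinetic m Finset.univ v := by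
  have h : m i * ‖v i‖ ^ 2 ≤ ∑ l, m l * ‖v l‖ ^ 2 :=
    Finset.single_le_sum (f := fun l => m l * ‖v l‖ ^ 2)
      (fun l _ => mul_nonneg (hm l).le (sq_nonneg _)) (Finset.mem_univ i)
  have := hm i
  rw [div_mul_eq_mul_div, le_div_iff₀ this]
  unfold kinetic
  linarith

theorem tendsto_pos (hq : IsBinaryCollisionSolution m T j k q) (hT : 0 < T) (i : Fin N) :
    Tendsto (fun t => q t i) (𝓝[>] 0) (𝓝 (q 0 i)) := by
  have h := (hq.continuousOn i 0 (left_mem_Icc.2 hT.le)).tendsto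
  rw [nhdsWithin_Icc_eq_nhdsGE hT] at h
  exact h.mono_left (nhdsWithin_mono _ Ioi_subset_Ici_self)

theorem exists_isPerturbedCollision (hq : IsBinaryCollisionSolution m T j k q)
    (hm : ∀ i, 0 < m i) (hT : 0 < T) (hjk : j ≠ k) :
    ∃ C τ, 0 ≤ C ∧ 0 < τ ∧ τ < T ∧
      (∀ t ∈ Ioc 0 τ, ‖extAccel m j k (q t) j‖ ≤ C ∧ ‖extAccel m j k (q t) k‖ ≤ C) ∧
      IsPerturbedCollision (m j + m k) (C + C) τ (fun t => q t k - q t j)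
        (fun t => velocity q t k - velocity q t j)
        (fun t => extAccel m j k (q t) k - extAccel m j k (q t) j) := by
  obtain ⟨C₁, hC₁, h1⟩ := hq.exists_norm_extAccel_le hT (Or.inl rfl)
  obtain ⟨C₂, hC₂, h2⟩ := hq.exists_norm_extAccel_le hT (Or.inr rfl)
  obtain ⟨τ', hτ', hsub⟩ := mem_nhdsGT_iff_exists_Ioc_subset.1 (h1.and h2)
  have hτ'0 : (0 : ℝ) < τ' := hτ'
  set τ := min τ' (T / 2) with hτ
  have hτ0 : 0 < τ := by positivity
  have hτT : τ < T := by linarith [min_le_right τ' (T / 2)]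
  have hmem : ∀ t ∈ Ioc 0 τ, t ∈ Ioo 0 T := fun t ht => ⟨ht.1, ht.2.trans_lt hτT⟩
  have hb : ∀ t ∈ Ioc 0 τ, ‖extAccel m j k (q t) j‖ ≤ max C₁ C₂ ∧
      ‖extAccel m j k (q t) k‖ ≤ max C₁ C₂ := fun t ht =>
    have h := hsub ⟨ht.1, ht.2.trans (min_le_left _ _)⟩
    ⟨h.1.trans (le_max_left _ _), h.2.trans (le_max_right _ _)⟩
  refine ⟨max C₁ C₂, τ, hC₁.trans (le_max_left _ _), hτ0, hτT, hb, ?_⟩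
  refine ⟨add_pos (hm j) (hm k), hτ0, fun t ht => ?_, fun t ht => ?_, fun t ht => ?_,
    fun t ht => hq.sub_ne_zero (hmem t ht) hjk.symm, ?_, ?_⟩
  · exact (hq.hasDerivAt (hmem t ht) k).sub (hq.hasDerivAt (hmem t ht) j)
  · refine ((hq.hasDerivAt_velocity hm (hmem t ht) k).sub
      (hq.hasDerivAt_velocity hm (hmem t ht) j)).congr_deriv ?_
    rw [accel_left m hjk, accel_right m hjk, add_mul, add_smul]
    abel
  · exact (norm_sub_le _ _).trans (add_le_add (hb t ht).2 (hb t ht).1)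
  · have h := (hq.tendsto_pos hT k).sub (hq.tendsto_pos hT j)
    rwa [← hq.collide, sub_self] at h
  · have hK : IntervalIntegrable (fun t => kinetic m Finset.univ (velocity q t)) volume 0 τ :=
      (hq.intervalIntegrable_kinetic hm hT).mono_set
        (by rw [uIcc_of_le hτ0.le, uIcc_of_le hT.le]; exact Icc_subset_Icc_right hτT.le)
    refine (hK.const_mul (4 / m k + 4 / m j)).mono_fun
      (((measurable_velocity q k).sub (measurable_velocity q j)).norm.pow_const 2
        |>.aestronglyMeasurable) (Eventually.of_forall fun t => ?_)
    have := hm k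
    have := hm j
    have hK0 := kinetic_nonneg hm Finset.univ (velocity q t)
    beta_reduce
    rw [Real.norm_of_nonneg (by positivity), Real.norm_of_nonneg (by positivity)]
    have hk := norm_velocity_sq_le hm (velocity q t) k
    have hj := norm_velocity_sq_le hm (velocity q t) j
    have h3 : ‖velocity q t k - velocity q t j‖ ^ 2
        ≤ 2 * (‖velocity q t k‖ ^ 2 + ‖velocity q t j‖ ^ 2) :=
      (pow_le_pow_left₀ (norm_nonneg _) (norm_sub_le _ _) 2).trans (add_sq_le)
    calc _ ≤ _ := h3
      _ ≤ 2 * (2 / m k * kinetic m Finset.univ (velocity q t)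
            + 2 / m j * kinetic m Finset.univ (velocity q t)) := by gcongr
      _ = _ := by ring

/-- The vector `q_j - q_c` is a positive multiple of `q_j - q_k`, so both make the same angle with
the `z`-axis; passing to `q_k - q_j` gives the minus sign. -/
theorem tendsto_z_div_norm (hm : ∀ i, 0 < m i) {φ : ℝ}
    (hφ : Tendsto (polarAngle m j k q) (𝓝[>] 0) (𝓝 φ)) :
    Tendsto (fun t => (q t k - q t j) 2 / ‖q t k - q t j‖) (𝓝[>] 0) (𝓝 (-Real.cos φ)) := by
  refine ((Real.continuous_cos.tendsto φ).comp hφ).neg.congr fun t => ?_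
  have hj := hm j
  have hk := hm k
  have h1 : q t j - centerOfMass m j k q t = (m k / (m j + m k)) • (q t j - q t k) := by
    have h2 : q t j = ((m j + m k)⁻¹ * (m j + m k)) • q t j := by
      rw [inv_mul_cancel₀ (by positivity), one_smul]
    rw [centerOfMass]
    nth_rewrite 1 [h2]
    module
  have h3 : ⟪q t j - q t k, e 2⟫ = (q t j - q t k) 2 := by
    simp [e, EuclideanSpace.inner_single_right]
  have h4 : ‖e 2‖ = 1 := by simp [e]
  simp only [Function.comp, polarAngle]
  rw [h1, InnerProductGeometry.angle_smul_left_of_pos _ _ (by positivity),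
    InnerProductGeometry.cos_angle, h3, h4, mul_one, norm_sub_rev, ← neg_div]
  simp

/-- Along a collision in the direction of the `z`-axis, the `a`-component of
`m_k v_k - m_j v_j` is asymptotically nonpositive when `j`, `k` separate in the coordinate `a`. -/
theorem exists_local_bounds (hq : IsBinaryCollisionSolution m T j k q)
    (hm : ∀ i, 0 < m i) (hT : 0 < T) (hjk : j ≠ k) {φ : ℝ}
    (hφ : Tendsto (polarAngle m j k q) (𝓝[>] 0) (𝓝 φ)) (hφ' : φ = 0 ∨ φ = Real.pi)
    {a : Fin 3} (ha : a ≠ 2) {I₀ I₁ : Finset (Fin N)} (hsep : IsSeparated a T j k I₀ I₁ q) :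
    ∃ C τ, 0 ≤ C ∧ 0 < τ ∧ τ < T ∧
      (∀ t ∈ Ioc 0 τ, -C ≤ m k * accel m (q t) k a - m j * accel m (q t) j a
        + 2 * (m j * m k) * (‖q t k - q t j‖⁻¹ ^ 3 * (q t k a - q t j a))) ∧
      (∀ t ∈ Ioc 0 τ, -C ≤ m k * velocity q t k a - m j * velocity q t j a) ∧
      (∀ η > 0, ∀ᶠ t in 𝓝[>] 0, m k * velocity q t k a - m j * velocity q t j a ≤ η) ∧
      (∀ᶠ t in 𝓝[>] 0, t ≤ ‖q t k - q t j‖) ∧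
      Tendsto (fun t => (q t k a - q t j a) / ‖q t k - q t j‖) (𝓝[>] 0) (𝓝 0) := by
  obtain ⟨C, τ, hC, hτ, hτT, hext, hcol⟩ := hq.exists_isPerturbedCollision hm hT hjk
  have hmj := hm j
  have hmk := hm k
  have hz := tendsto_z_div_norm hm hφ
  have hcos : (-Real.cos φ) ^ 2 = 1 := by rcases hφ' with rfl | rfl <;> simp
  have hmem : ∀ t ∈ Ioc 0 τ, t ∈ Ioo 0 T := fun t ht => ⟨ht.1, ht.2.trans_lt hτT⟩
  set A : ℝ → ℝ := fun t => m k * accel m (q t) k a - m j * accel m (q t) j a with hA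
  set u : ℝ → ℝ := fun t => m k * q t k a - m j * q t j a with hu
  set u' : ℝ → ℝ := fun t => m k * velocity q t k a - m j * velocity q t j a with hu'
  set D := m k * C + m j * C with hD
  have hD0 : 0 ≤ D := by positivity
  have hAeq : ∀ t, A t = -(2 * (m j * m k) * (‖q t k - q t j‖⁻¹ ^ 3 * (q t k a - q t j a)))
      + (m k * extAccel m j k (q t) k a - m j * extAccel m j k (q t) j a) := by
    intro t
    simp only [hA, accel_left m hjk, accel_right m hjk]
    simp
    ring
  have hAb : ∀ t ∈ Ioc 0 τ,
      |m k * extAccel m j k (q t) k a - m j * extAccel m j k (q t) j a| ≤ D := by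
    intro t ht
    refine (abs_sub _ _).trans ?_
    rw [abs_mul, abs_mul, abs_of_pos hmj, abs_of_pos hmk]
    have h1 := (IsPerturbedCollision.abs_coord_le _ a).trans (hext t ht).1
    have h2 := (IsPerturbedCollision.abs_coord_le _ a).trans (hext t ht).2
    exact add_le_add (mul_le_mul_of_nonneg_left h2 hmk.le) (mul_le_mul_of_nonneg_left h1 hmj.le)
  have hρ : ∀ t ∈ Icc 0 T, 0 ≤ q t k a - q t j a := fun t ht => by
    linarith [(hsep.left t ht).2, (hsep.right t ht).1, hsep.eq_zero]
  -- Separation keeps `k` on the positive side of `j`, so their mutual attraction, singular as it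
  -- is, has a favourable sign.
  have hAle : ∀ t ∈ Ioc 0 τ, A t ≤ D := by
    intro t ht
    have h1 := hρ t (Ioo_subset_Icc_self (hmem t ht))
    have h2 : 0 ≤ 2 * (m j * m k) * (‖q t k - q t j‖⁻¹ ^ 3 * (q t k a - q t j a)) := by positivity
    linarith [hAeq t, (abs_le.1 (hAb t ht)).2]
  have hud : ∀ t ∈ Ioc 0 τ, HasDerivAt u (u' t) t := fun t ht =>
    ((IsPerturbedCollision.hasDerivAt_coord (hq.hasDerivAt (hmem t ht) k) a).const_mul _).fun_sub
      ((IsPerturbedCollision.hasDerivAt_coord (hq.hasDerivAt (hmem t ht) j) a).const_mul _)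
  have hu'd : ∀ t ∈ Ioc 0 τ, HasDerivAt u' (A t) t := fun t ht =>
    ((IsPerturbedCollision.hasDerivAt_coord
      (hq.hasDerivAt_velocity hm (hmem t ht) k) a).const_mul _).fun_sub
      ((IsPerturbedCollision.hasDerivAt_coord
        (hq.hasDerivAt_velocity hm (hmem t ht) j) a).const_mul _)
  have hanti : ∀ s ∈ Ioc 0 τ, ∀ t ∈ Ioc 0 τ, s ≤ t → u' t - D * t ≤ u' s - D * s := by
    have hd : ∀ t ∈ Ioc 0 τ, HasDerivAt (fun s => u' s - D * s) (A t - D) t := fun t ht =>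
      ((hu'd t ht).fun_sub ((hasDerivAt_id t).const_mul D)).congr_deriv (by simp)
    have : AntitoneOn (fun s => u' s - D * s) (Ioc 0 τ) := by
      refine antitoneOn_of_deriv_nonpos (convex_Ioc 0 τ)
        (fun t ht => (hd t ht).continuousAt.continuousWithinAt)
        (fun t ht => (hd t (interior_subset ht)).differentiableAt.differentiableWithinAt)
        fun t ht => ?_
      rw [(hd t (interior_subset ht)).deriv]
      linarith [hAle t (interior_subset ht)]
    exact fun s hs t ht hst => this hs ht hst
  have huc : ContinuousOn u (Icc 0 T) := by
    have h : ∀ i, ContinuousOn (fun t => q t i a) (Icc 0 T) := fun i =>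
      (EuclideanSpace.proj a : Space →L[ℝ] ℝ).continuous.comp_continuousOn (hq.continuousOn i)
    exact (continuousOn_const.mul (h k)).sub (continuousOn_const.mul (h j))
  -- As `u' - D t` decreases, `u'` at `t` is at most its value at an earlier mean value point plus
  -- `D t`. The slope there is bounded through `ρ_a / t`, because both masses move outward from a
  -- common coordinate.
  have hupper : ∀ t ∈ Ioc 0 τ, u' t ≤ (m j + m k) * ((q t k - q t j) a / t) + D * t := by
    intro t ht
    have htT := Ioo_subset_Icc_self (hmem t ht)
    obtain ⟨ξ, hξ, hξ'⟩ := exists_hasDerivAt_eq_slope u u' ht.1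
      (huc.mono (Icc_subset_Icc_right htT.2)) fun s hs => hud s ⟨hs.1, hs.2.le.trans ht.2⟩
    have h1 := hanti ξ ⟨hξ.1, hξ.2.le.trans ht.2⟩ t ht hξ.2.le
    have h2 : u' ξ ≤ (m j + m k) * ((q t k - q t j) a / t) := by
      rw [hξ', sub_zero, ← mul_div_assoc]
      have ht0 := ht.1
      gcongr
      simp only [hu, PiLp.sub_apply]
      have h3 := (hsep.left t htT).2
      have h4 := (hsep.right t htT).1
      have h5 := hsep.eq_zero
      nlinarith
    have h3 : 0 ≤ D * ξ := mul_nonneg hD0 hξ.1.le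
    linarith
  refine ⟨D + |u' τ| + D * τ, τ, by positivity, hτ, hτT, fun t ht => ?_, fun t ht => ?_,
    fun η hη => ?_, ?_, ?_⟩
  · have h1 := hAeq t
    have h2 := (abs_le.1 (hAb t ht)).1
    have h3 : 0 ≤ D * τ := by positivity
    have h4 := abs_nonneg (u' τ)
    change _ ≤ A t + _
    linarith
  · have h1 := hanti t ht τ (right_mem_Ioc.2 hτ) ht.2
    have h2 : 0 ≤ D * t := mul_nonneg hD0 ht.1.le
    change _ ≤ u' t
    linarith [neg_abs_le (u' τ)]
  · have hlim : Tendsto (fun t => (m j + m k) * ((q t k - q t j) a / t) + D * t) (𝓝[>] 0)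
        (𝓝 0) := by
      have hid : Tendsto (fun s : ℝ => D * s) (𝓝[>] 0) (𝓝 0) := by
        have : Tendsto (fun s : ℝ => D * s) (𝓝 0) (𝓝 (D * 0)) := tendsto_id.const_mul D
        simpa using this.mono_left nhdsWithin_le_nhds
      simpa using ((hcol.tendsto_coord_div hcos hz ha).const_mul (m j + m k)).add hid
    filter_upwards [hlim.eventually_le_const hη, Ioc_mem_nhdsGT hτ] with t h1 ht
    exact (hupper t ht).trans h1
  · obtain ⟨σ, hσ, -, -, hlow⟩ := hcol.exists_monotoneOn_norm
    filter_upwards [Ioc_mem_nhdsGT hσ] with t ht using hlow t ht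
  · exact hcol.tendsto_coord_div_norm hcos hz ha

end IsBinaryCollisionSolution

/-! ### Effect of the deformation on kinetic and potential energy. -/

section

theorem norm_add_smul_e_sq (p : Space) (s : ℝ) (a : Fin 3) :
    ‖p + s • e a‖ ^ 2 = ‖p‖ ^ 2 + 2 * s * p a + s ^ 2 := by
  rw [norm_add_sq_real, norm_smul, inner_smul_right]
  simp [e, EuclideanSpace.inner_single_right]
  ring

theorem norm_le_norm_add_smul_e {p : Space} {s : ℝ} {a : Fin 3} (h : 0 ≤ s * p a) :
    ‖p‖ ≤ ‖p + s • e a‖ := by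
  rw [← sq_le_sq₀ (norm_nonneg _) (norm_nonneg _), norm_add_smul_e_sq]
  nlinarith [sq_nonneg s]

/-- Pushing apart two masses whose relative position is almost orthogonal to the direction of the
push lowers the potential at least as much as the first order term predicts. -/
theorem inv_norm_add_smul_e_le {p : Space} (hp : p ≠ 0) {δ : ℝ} {a : Fin 3} (hδ : 0 ≤ δ)
    (hδr : δ ≤ ‖p‖ / 4) (hx : 0 ≤ p a) (hxr : p a ≤ ‖p‖ / 4) :
    ‖p + (2 * δ) • e a‖⁻¹ ≤ ‖p‖⁻¹ - 2 * δ * (‖p‖⁻¹ ^ 3 * p a) := by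
  have hr := norm_pos_iff.2 hp
  set r := ‖p‖ with hrdef
  have hle : r ≤ ‖p + (2 * δ) • e a‖ := norm_le_norm_add_smul_e (by positivity)
  have hsq := norm_add_smul_e_sq p (2 * δ) a
  rw [← hrdef] at hsq
  set R := ‖p + (2 * δ) • e a‖ with hR
  have hR0 : 0 < R := hr.trans_le hle
  -- After scaling by `r` and squaring, the claim becomes `(1 - 2ΔX)² (1 + 4ΔX + 4Δ²) ≥ 1`. The
  -- linear terms cancel, and `X, Δ ≤ 1 / 4` lets the term `4Δ²` absorb the negative ones.
  obtain ⟨X, hX⟩ : ∃ X, p a = X * r := ⟨p a / r, by field_simp⟩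
  obtain ⟨Δ, hΔ⟩ : ∃ Δ, δ = Δ * r := ⟨δ / r, by field_simp⟩
  rw [hX] at hx hxr hsq ⊢
  rw [hΔ] at hδ hδr hsq ⊢
  have hX0 : 0 ≤ X := nonneg_of_mul_nonneg_left hx hr
  have hΔ0 : 0 ≤ Δ := nonneg_of_mul_nonneg_left hδ hr
  have hX1 : X ≤ 1 / 4 := le_of_mul_le_mul_right (by linarith) hr
  have hΔ1 : Δ ≤ 1 / 4 := le_of_mul_le_mul_right (by linarith) hr
  have e1 : r⁻¹ - 2 * (Δ * r) * (r⁻¹ ^ 3 * (X * r)) = r⁻¹ * (1 - 2 * (Δ * X)) := by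
    field_simp
  have hP : Δ * X ≤ 1 / 16 := by nlinarith
  have hP0 : 0 ≤ Δ * X := mul_nonneg hΔ0 hX0
  rw [e1, inv_eq_one_div, div_le_iff₀ hR0]
  have h2 : 1 ^ 2 ≤ (r⁻¹ * (1 - 2 * (Δ * X)) * R) ^ 2 := by
    rw [mul_pow, hsq]
    have e2 : (r⁻¹ * (1 - 2 * (Δ * X))) ^ 2
        * (r ^ 2 + 2 * (2 * (Δ * r)) * (X * r) + (2 * (Δ * r)) ^ 2)
        = (1 - 2 * (Δ * X)) ^ 2 * (1 + 4 * (Δ * X) + 4 * Δ ^ 2) := by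
      field_simp
      ring
    rw [e2]
    have e3 : (1 - 2 * (Δ * X)) ^ 2 * (1 + 4 * (Δ * X) + 4 * Δ ^ 2)
        = 1 + Δ ^ 2 * (4 - 12 * X ^ 2 - 16 * (Δ * X)) + 16 * (Δ * X) ^ 3
          + 16 * (Δ * X) ^ 2 * Δ ^ 2 := by ring
    rw [e3]
    have h3 : 0 ≤ 4 - 12 * X ^ 2 - 16 * (Δ * X) := by nlinarith
    have h4 : 0 ≤ Δ ^ 2 * (4 - 12 * X ^ 2 - 16 * (Δ * X)) := by positivity
    have h5 : 0 ≤ 16 * (Δ * X) ^ 3 := by positivity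
    have h6 : 0 ≤ 16 * (Δ * X) ^ 2 * Δ ^ 2 := by positivity
    linarith
  have h7 : 0 ≤ r⁻¹ * (1 - 2 * (Δ * X)) * R :=
    mul_nonneg (mul_nonneg (inv_nonneg.2 hr.le) (by linarith)) hR0.le
  exact (sq_le_sq₀ zero_le_one h7).1 h2

/-- The squared norm grows by at least `2sγ`. Dividing by the sum of the two norms and then by their
product, all norms being at most `R + 2`, costs the factor `(R + 2)³`. -/
theorem inv_norm_add_smul_e_le_of_le {p : Space} {s γ R : ℝ} {a : Fin 3} (hγ : 0 < γ)
    (hp : γ ≤ p a) (hR : ‖p‖ ≤ R) (hs : 0 ≤ s) (hs2 : s ≤ 2) :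
    ‖p + s • e a‖⁻¹ ≤ ‖p‖⁻¹ - s * (γ / (R + 2) ^ 3) := by
  have hd : 0 < ‖p‖ := by
    have := IsPerturbedCollision.abs_coord_le p a
    linarith [le_abs_self (p a)]
  have hle : ‖p‖ ≤ ‖p + s • e a‖ := norm_le_norm_add_smul_e (mul_nonneg hs (hγ.le.trans hp))
  have hub : ‖p + s • e a‖ ≤ R + 2 := by
    refine (norm_add_le _ _).trans ?_
    rw [norm_smul, Real.norm_of_nonneg hs]
    have : ‖e a‖ = 1 := by simp [e]
    rw [this]
    linarith
  have hsq := norm_add_smul_e_sq p s a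
  set d := ‖p‖
  set D := ‖p + s • e a‖
  have hD : 0 < D := hd.trans_le hle
  have hR2 : 0 < R + 2 := hD.trans_le hub
  have h1 : 2 * s * γ ≤ (D - d) * (D + d) := by nlinarith [sq_nonneg s]
  have h2 : s * γ ≤ (D - d) * (R + 2) := by
    have : (D - d) * (D + d) ≤ (D - d) * (2 * (R + 2)) :=
      mul_le_mul_of_nonneg_left (by linarith) (by linarith)
    linarith
  have h3 : d⁻¹ - D⁻¹ = (D - d) / (d * D) := by field_simp
  have h4 : s * (γ / (R + 2) ^ 3) ≤ (D - d) / (d * D) := by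
    rw [← mul_div_assoc, div_le_div_iff₀ (by positivity) (by positivity)]
    have h5 : d * D ≤ (R + 2) * (R + 2) := mul_le_mul (by linarith) hub hD.le hR2.le
    calc s * γ * (d * D) ≤ ((D - d) * (R + 2)) * ((R + 2) * (R + 2)) :=
          mul_le_mul h2 h5 (by positivity) (mul_nonneg (by linarith) hR2.le)
      _ = (D - d) * (R + 2) ^ 3 := by ring
  linarith

theorem push_nonneg {ε t : ℝ} (ht : 0 ≤ t) : 0 ≤ push ε t := by
  unfold push
  split_ifs with h
  · exact mul_nonneg ht (by linarith)
  · positivity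

theorem push_le (ε t : ℝ) : push ε t ≤ ε ^ 2 := by
  unfold push
  split_ifs with h
  · nlinarith [sq_nonneg (t - ε)]
  · exact le_rfl

theorem push_of_le {ε t : ℝ} (h : t ≤ ε) : push ε t = t * (2 * ε - t) := if_pos h

theorem push_of_ge {ε t : ℝ} (h : ε ≤ t) : push ε t = ε ^ 2 := by
  unfold push
  split_ifs with h'
  · obtain rfl := le_antisymm h h'; ring
  · rfl

theorem continuous_push (ε : ℝ) : Continuous (push ε) := by
  unfold push
  refine Continuous.if_le (by fun_prop) (by fun_prop) continuous_id continuous_const fun t ht => ?_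
  obtain rfl : t = ε := ht
  ring

theorem hasDerivAt_push_of_lt {ε t : ℝ} (h : t < ε) : HasDerivAt (push ε) (2 * (ε - t)) t := by
  have h1 : HasDerivAt (fun s => s * (2 * ε - s)) (2 * (ε - t)) t :=
    ((hasDerivAt_id t).fun_mul ((hasDerivAt_id t).const_sub (2 * ε))).congr_deriv (by simp; ring)
  refine h1.congr_of_eventuallyEq ?_
  filter_upwards [Iio_mem_nhds h] with s hs using push_of_le (le_of_lt hs)

theorem hasDerivAt_push_of_gt {ε t : ℝ} (h : ε < t) : HasDerivAt (push ε) 0 t := by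
  refine (hasDerivAt_const t (ε ^ 2)).congr_of_eventuallyEq ?_
  filter_upwards [Ioi_mem_nhds h] with s hs using push_of_ge (le_of_lt hs)

/-- The displacement of the `i`-th mass in the deformed path. -/
def shift {N : ℕ} (ε : ℝ) (j k : Fin N) (I₀ I₁ : Finset (Fin N)) (t : ℝ) (i : Fin N) : ℝ :=
  if i = j then -push ε t else if i = k then push ε t
  else if i ∈ I₀ then -ε ^ 2 else if i ∈ I₁ then ε ^ 2 else 0

variable {N : ℕ}

theorem deform_apply (a : Fin 3) (ε : ℝ) (j k : Fin N) (I₀ I₁ : Finset (Fin N)) (q : Path N)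
    (t : ℝ) (i : Fin N) :
    deform a ε j k I₀ I₁ q t i = q t i + shift ε j k I₀ I₁ t i • e a := by
  unfold deform shift
  split_ifs <;> simp [sub_eq_add_neg]

theorem continuous_shift (ε : ℝ) (j k : Fin N) (I₀ I₁ : Finset (Fin N)) (i : Fin N) :
    Continuous fun t => shift ε j k I₀ I₁ t i := by
  unfold shift
  have := continuous_push ε
  split_ifs <;> fun_prop

/-- If the push has derivative `d`, then `shiftDeriv` is the derivative of the displacement. -/
def shiftDeriv (j k : Fin N) (d : ℝ) (i : Fin N) : ℝ :=
  if i = j then -d else if i = k then d else 0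

theorem hasDerivAt_shift {ε : ℝ} {j k : Fin N} {I₀ I₁ : Finset (Fin N)} {t d : ℝ}
    (h : HasDerivAt (push ε) d t) (i : Fin N) :
    HasDerivAt (fun s => shift ε j k I₀ I₁ s i) (shiftDeriv j k d i) t := by
  unfold shift shiftDeriv
  split_ifs
  · exact h.fun_neg
  · exact h
  all_goals exact hasDerivAt_const _ _

theorem velocity_deform {m : Fin N → ℝ} {T : ℝ} {j k : Fin N} {q : Path N}
    (hq : IsBinaryCollisionSolution m T j k q) (a : Fin 3) {ε : ℝ} (I₀ I₁ : Finset (Fin N))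
    {t d : ℝ} (ht : t ∈ Ioo 0 T) (h : HasDerivAt (push ε) d t) (i : Fin N) :
    velocity (deform a ε j k I₀ I₁ q) t i = velocity q t i + shiftDeriv j k d i • e a := by
  have h1 := (hq.hasDerivAt ht i).fun_add
    ((hasDerivAt_shift (j := j) (k := k) (I₀ := I₀) (I₁ := I₁) h i).smul_const (e a))
  rw [← h1.deriv]
  unfold velocity
  congr 1
  funext s
  exact deform_apply ..

theorem kinetic_add_shiftDeriv (m : Fin N → ℝ) {I : Finset (Fin N)} {j k : Fin N} (hj : j ∈ I)
    (hk : k ∈ I) (hjk : j ≠ k) (v : Fin N → Space) (d : ℝ) (a : Fin 3) :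
    kinetic m I (fun i => v i + shiftDeriv j k d i • e a)
      = kinetic m I v + (d * (m k * v k a - m j * v j a) + 1 / 2 * (m j + m k) * d ^ 2) := by
  have h1 : ∑ i ∈ I, m i * (2 * shiftDeriv j k d i * v i a + shiftDeriv j k d i ^ 2)
      = 2 * d * (m k * v k a - m j * v j a) + (m j + m k) * d ^ 2 := by
    rw [← Finset.sum_subset (s₁ := {j, k}), Finset.sum_pair hjk]
    · simp [shiftDeriv, hjk.symm]; ring
    · simp [Finset.insert_subset_iff, hj, hk]
    · intro i _ hi
      simp only [Finset.mem_insert, Finset.mem_singleton, not_or] at hi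
      simp [shiftDeriv, hi.1, hi.2]
  unfold kinetic
  simp only [norm_add_smul_e_sq, add_assoc, mul_add, Finset.sum_add_distrib] at h1 ⊢
  linarith

/-- Every pair contributes a nonnegative gain, so any single pair bounds the total gain from below.
-/
theorem potential_deform_gain {m : Fin N → ℝ} (hm : ∀ i, 0 < m i) {I : Finset (Fin N)}
    {x y : Fin N → Space} (hx : Function.Injective x)
    (hxy : ∀ i ∈ I, ∀ l ∈ I, i ≠ l → ‖x i - x l‖ ≤ ‖y i - y l‖) {i l : Fin N} (hi : i ∈ I)
    (hl : l ∈ I) (hil : i ≠ l) :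
    m i * m l * (‖x i - x l‖⁻¹ - ‖y i - y l‖⁻¹) ≤ potential m I x - potential m I y := by
  have hterm : ∀ b ∈ I, ∀ c ∈ I, b ≠ c →
      0 ≤ m b * m c * (‖x b - x c‖⁻¹ - ‖y b - y c‖⁻¹) := by
    intro b hb c hc hbc
    refine mul_nonneg (mul_nonneg (hm b).le (hm c).le) (sub_nonneg.2 ?_)
    exact inv_anti₀ (norm_pos_iff.2 (sub_ne_zero.2 (hx.ne hbc))) (hxy b hb c hc hbc)
  have hsum : potential m I x - potential m I y
      = ∑ p ∈ (I ×ˢ I).filter (fun p => p.1 < p.2),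
        m p.1 * m p.2 * (‖x p.1 - x p.2‖⁻¹ - ‖y p.1 - y p.2‖⁻¹) := by
    rw [potential, potential, ← Finset.sum_sub_distrib]
    exact Finset.sum_congr rfl fun p _ => by ring
  have hmain : ∀ b ∈ I, ∀ c ∈ I, b < c →
      m b * m c * (‖x b - x c‖⁻¹ - ‖y b - y c‖⁻¹) ≤ potential m I x - potential m I y := by
    intro b hb c hc hbc
    rw [hsum]
    refine Finset.single_le_sum
      (f := fun p : Fin N × Fin N => m p.1 * m p.2 * (‖x p.1 - x p.2‖⁻¹ - ‖y p.1 - y p.2‖⁻¹))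
      (fun p hp => ?_) (a := (b, c)) (by simp [hb, hc, hbc])
    simp only [Finset.mem_filter, Finset.mem_product] at hp
    exact hterm _ hp.1.1 _ hp.1.2 hp.2.ne
  rcases lt_or_gt_of_ne hil with h | h
  · exact hmain i hi l hl h
  · have := hmain l hl i hi h
    rwa [mul_comm (m l), norm_sub_rev (x l), norm_sub_rev (y l)] at this

theorem kinetic_le_univ {m : Fin N → ℝ} (hm : ∀ i, 0 < m i) (I : Finset (Fin N))
    (v : Fin N → Space) : kinetic m I v ≤ kinetic m Finset.univ v :=
  mul_le_mul_of_nonneg_left (Finset.sum_le_sum_of_subset_of_nonneg (Finset.subset_univ I)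
    fun i _ _ => mul_nonneg (hm i).le (sq_nonneg _)) (by norm_num)

theorem potential_le_univ {m : Fin N → ℝ} (hm : ∀ i, 0 < m i) (I : Finset (Fin N))
    (x : Fin N → Space) : potential m I x ≤ potential m Finset.univ x :=
  Finset.sum_le_sum_of_subset_of_nonneg
    (Finset.filter_subset_filter _ (Finset.product_subset_product (Finset.subset_univ I)
      (Finset.subset_univ I)))
    fun p _ _ => div_nonneg (mul_nonneg (hm p.1).le (hm p.2).le) (norm_nonneg _)

theorem aestronglyMeasurable_potential (m : Fin N → ℝ) (I : Finset (Fin N)) {x : Path N}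
    {s : Set ℝ} (hs : MeasurableSet s) (hx : ∀ i, ContinuousOn (fun t => x t i) s) :
    AEStronglyMeasurable (fun t => potential m I (x t)) (volume.restrict s) := by
  have h1 : ∀ i, AEMeasurable (fun t => x t i) (volume.restrict s) := fun i =>
    (hx i).aemeasurable hs
  unfold potential
  refine AEMeasurable.aestronglyMeasurable ?_
  exact Finset.aemeasurable_fun_sum _ fun p _ =>
    aemeasurable_const.div ((h1 p.1).sub (h1 p.2)).norm

theorem measurable_kinetic (m : Fin N → ℝ) (I : Finset (Fin N)) (x : Path N) :
    Measurable fun t => kinetic m I (velocity x t) := by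
  unfold kinetic
  exact (Finset.measurable_fun_sum _ fun i _ =>
    ((measurable_velocity x i).norm.pow_const 2).const_mul (m i)).const_mul _

theorem lagrangian_nonneg {m : Fin N → ℝ} (hm : ∀ i, 0 < m i) (I : Finset (Fin N)) (x : Path N)
    (t : ℝ) : 0 ≤ lagrangian m I x t :=
  add_nonneg (kinetic_nonneg hm _ _) (potential_nonneg hm _ _)

/-- A path continuous in the open interval has finite action if its Lagrangian has an integrable
upper bound. -/
theorem hasFiniteAction_of_le {m : Fin N → ℝ} (hm : ∀ i, 0 < m i) (I : Finset (Fin N)) {T : ℝ}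
    (hT : 0 < T) {x : Path N} (hx : ∀ i, ContinuousOn (fun t => x t i) (Ioo 0 T)) {g : ℝ → ℝ}
    (hg : IntervalIntegrable g volume 0 T) {ε : ℝ}
    (hle : ∀ t ∈ Ioo 0 T, t ≠ ε → lagrangian m I x t ≤ g t) : HasFiniteAction m I T x := by
  unfold HasFiniteAction
  rw [intervalIntegrable_iff_integrableOn_Ioo_of_le hT.le] at hg ⊢
  refine hg.mono' ?_ ?_
  · exact (measurable_kinetic m I x).aestronglyMeasurable.add
      (aestronglyMeasurable_potential m I measurableSet_Ioo hx)
  -- One exceptional time is harmless; it allows the branch point of the push to be skipped.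
  · filter_upwards [ae_restrict_mem measurableSet_Ioo,
      ae_restrict_of_ae (Measure.ae_ne volume ε)] with t ht hne
    rw [Real.norm_of_nonneg (lagrangian_nonneg hm I x t)]
    exact hle t ht hne

end

/-! ### Comparison of the actions. -/

section

theorem integral_le_of_three_bounds {D h h' : ℝ → ℝ} {T T₁ ε B G : ℝ} (hε : 0 < ε) (hεT : ε ≤ T₁)
    (hT : T₁ < T) (hD : IntervalIntegrable D volume 0 T) (hc : ContinuousOn h (Icc 0 ε))
    (h0 : h 0 = 0) (hd : ∀ t ∈ Ioo 0 ε, HasDerivAt h (h' t) t)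
    (h1 : ∀ t ∈ Ioo 0 ε, D t ≤ h' t + B) (h2 : ∀ t ∈ Ioo ε T₁, D t ≤ 0)
    (h3 : ∀ t ∈ Ioo T₁ T, D t ≤ -G) :
    ∫ t in (0 : ℝ)..T, D t ≤ h ε + B * ε - G * (T - T₁) := by
  have hsub : ∀ a b, 0 ≤ a → a ≤ b → b ≤ T → IntervalIntegrable D volume a b :=
    fun a b ha hab hb => hD.mono_set (by
      rw [uIcc_of_le hab, uIcc_of_le (ha.trans (hab.trans hb))]; exact Icc_subset_Icc ha hb)
  have i1 := hsub 0 ε le_rfl hε.le (hεT.trans hT.le)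
  have i2 := hsub ε T₁ hε.le hεT hT.le
  have i3 := hsub T₁ T (hε.le.trans hεT) hT.le le_rfl
  have b1 : ∫ t in (0 : ℝ)..ε, D t ≤ (h ε + B * ε) - (h 0 + B * 0) :=
    intervalIntegral.integral_le_sub_of_hasDeriv_right_of_le (g := fun t => h t + B * t)
      (g' := fun t => h' t + B) hε.le (hc.add (by fun_prop))
      (fun t ht => (((hd t ht).fun_add ((hasDerivAt_id t).const_mul B)).congr_deriv
        (by simp)).hasDerivWithinAt)
      ((intervalIntegrable_iff_integrableOn_Icc_of_le hε.le).1 i1) h1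
  have b2 : ∫ t in ε..T₁, D t ≤ ∫ t in ε..T₁, (0 : ℝ) :=
    intervalIntegral.integral_mono_on_of_le_Ioo hεT i2 intervalIntegrable_const h2
  have b3 : ∫ t in T₁..T, D t ≤ ∫ t in T₁..T, -G :=
    intervalIntegral.integral_mono_on_of_le_Ioo hT.le i3 intervalIntegrable_const h3
  rw [intervalIntegral.integral_zero] at b2
  rw [intervalIntegral.integral_const, smul_eq_mul] at b3
  rw [← intervalIntegral.integral_add_adjacent_intervals i1 (i2.trans i3),
    ← intervalIntegral.integral_add_adjacent_intervals i2 i3]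
  rw [h0] at b1
  linarith

variable {N : ℕ} {m : Fin N → ℝ} {T : ℝ} {j k : Fin N} {q : Path N} {I I₀ I₁ : Finset (Fin N)}
  {a : Fin 3}

/-- Since `-ε² ≤ -push ≤ push ≤ ε²`, the displacements are ordered like the coordinates: `I₀`, then
`j`, then `k`, then `I₁`. Two masses in the same outer group move rigidly, hence their mutual order
is irrelevant. -/
theorem IsSeparated.shift_mul_nonneg (hsep : IsSeparated a T j k I₀ I₁ q)
    (hI : I \ {j, k} = I₀ ∪ I₁) (hdisj : Disjoint I₀ I₁) (hjk : j ≠ k) (ε : ℝ) {t : ℝ}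
    (ht : t ∈ Icc 0 T) {i l : Fin N} (hi : i ∈ I) (hl : l ∈ I) :
    0 ≤ (shift ε j k I₀ I₁ t i - shift ε j k I₀ I₁ t l) * (q t i - q t l) a := by
  have hp0 := push_nonneg (ε := ε) ht.1
  have hp1 := push_le ε t
  have h0 := hsep.eq_zero
  have hl1 := hsep.left t ht
  have hr1 := hsep.right t ht
  have class_of : ∀ i ∈ I,
      (shift ε j k I₀ I₁ t i = -push ε t ∧ i = j) ∨ (shift ε j k I₀ I₁ t i = push ε t ∧ i = k) ∨
      (shift ε j k I₀ I₁ t i = -ε ^ 2 ∧ q t i a ≤ q T j a) ∨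
      (shift ε j k I₀ I₁ t i = ε ^ 2 ∧ q T k a ≤ q t i a) := by
    intro i hi
    by_cases hij : i = j
    · exact Or.inl ⟨by simp [shift, hij], hij⟩
    by_cases hik : i = k
    · exact Or.inr (Or.inl ⟨by simp [shift, hik, hjk.symm], hik⟩)
    have hmem : i ∈ I₀ ∪ I₁ := by rw [← hI]; simp [hi, hij, hik]
    rcases Finset.mem_union.1 hmem with h | h
    · exact Or.inr (Or.inr (Or.inl ⟨by simp [shift, hij, hik, h], hsep.outer_left t ht i h⟩))
    · have h' : i ∉ I₀ := Finset.disjoint_right.1 hdisj h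
      exact Or.inr (Or.inr (Or.inr ⟨by simp [shift, hij, hik, h, h'], hsep.outer_right t ht i h⟩))
  rw [PiLp.sub_apply]
  rcases class_of i hi with ⟨h1, h2⟩ | ⟨h1, h2⟩ | ⟨h1, h2⟩ | ⟨h1, h2⟩ <;>
  rcases class_of l hl with ⟨h3, h4⟩ | ⟨h3, h4⟩ | ⟨h3, h4⟩ | ⟨h3, h4⟩ <;>
  rw [h1, h3] <;> (try subst h2) <;> (try subst h4) <;>
  first
  | simp; done
  | exact mul_nonneg (by linarith) (by linarith)
  | exact mul_nonneg_of_nonpos_of_nonpos (by linarith) (by linarith)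

theorem IsSeparated.norm_sub_le_deform (hsep : IsSeparated a T j k I₀ I₁ q)
    (hI : I \ {j, k} = I₀ ∪ I₁) (hdisj : Disjoint I₀ I₁) (hjk : j ≠ k) (ε : ℝ) {t : ℝ}
    (ht : t ∈ Icc 0 T) {i l : Fin N} (hi : i ∈ I) (hl : l ∈ I) :
    ‖q t i - q t l‖ ≤ ‖deform a ε j k I₀ I₁ q t i - deform a ε j k I₀ I₁ q t l‖ := by
  rw [deform_apply, deform_apply, add_sub_add_comm, ← sub_smul]
  exact norm_le_norm_add_smul_e (hsep.shift_mul_nonneg hI hdisj hjk ε ht hi hl)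

/-- Near time `T` some outer mass is strictly separated from the colliding mass on the other
side. -/
theorem IsSeparated.exists_outer_gain (hsep : IsSeparated a T j k I₀ I₁ q)
    (hq : IsBinaryCollisionSolution m T j k q) (hT : 0 < T)
    (hI : I \ {j, k} = I₀ ∪ I₁) (hdisj : Disjoint I₀ I₁) (hjk : j ≠ k) (hj : j ∈ I) (hk : k ∈ I)
    (hne : (I \ {j, k}).Nonempty) (hlt : q T j a < q T k a) :
    ∃ i ∈ I, ∃ l ∈ I, i ≠ l ∧ ∃ T₁ c : ℝ, 0 < T₁ ∧ T₁ < T ∧ 0 < c ∧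
      ∀ ε : ℝ, 0 < ε → ε ≤ T₁ → ε ≤ 1 → ∀ t ∈ Ioo T₁ T, c * ε ^ 2 ≤ ‖q t i - q t l‖⁻¹
        - ‖deform a ε j k I₀ I₁ q t i - deform a ε j k I₀ I₁ q t l‖⁻¹ := by
  have hTT : T ∈ Icc 0 T := right_mem_Icc.2 hT.le
  set γ := (q T k a - q T j a) / 2 with hγ
  have hγ0 : 0 < γ := by rw [hγ]; linarith
  have hbound : ∀ i l, ∃ R, 0 ≤ R ∧ ∀ t ∈ Icc 0 T, ‖q t i - q t l‖ ≤ R := by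
    intro i l
    obtain ⟨R, hR⟩ := isCompact_Icc.exists_bound_of_continuousOn
      ((hq.continuousOn i).sub (hq.continuousOn l))
    exact ⟨R, (norm_nonneg _).trans (hR T hTT), hR⟩
  -- Once `t ≥ ε`, each mass of the pair is displaced by `ε²`, in opposite directions. Pairing an
  -- outer mass with the far colliding mass is what produces the uniform gap `γ` near `T`.
  have key : ∀ i ∈ I, ∀ l ∈ I, i ≠ l → (∀ᶠ t in 𝓝[≤] T, γ ≤ (q t i - q t l) a) →
      (∀ ε t : ℝ, ε ≤ t → shift ε j k I₀ I₁ t i - shift ε j k I₀ I₁ t l = 2 * ε ^ 2) →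
      ∃ T₁ c : ℝ, 0 < T₁ ∧ T₁ < T ∧ 0 < c ∧
      ∀ ε : ℝ, 0 < ε → ε ≤ T₁ → ε ≤ 1 → ∀ t ∈ Ioo T₁ T, c * ε ^ 2 ≤ ‖q t i - q t l‖⁻¹
        - ‖deform a ε j k I₀ I₁ q t i - deform a ε j k I₀ I₁ q t l‖⁻¹ := by
    intro i hi l hl hil hev hshift
    obtain ⟨σ, hσ, hsub⟩ := mem_nhdsLE_iff_exists_Icc_subset.1 hev
    obtain ⟨R, hR0, hR⟩ := hbound i l
    refine ⟨max σ (T / 2), 2 * (γ / (R + 2) ^ 3), by positivity, max_lt hσ (by linarith),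
      by positivity, fun ε hε hεT hε1 t ht => ?_⟩
    have ht0 : T / 2 < t := (le_max_right _ _).trans_lt ht.1
    rw [deform_apply, deform_apply, add_sub_add_comm, ← sub_smul,
      hshift ε t (hεT.trans ht.1.le)]
    have h := inv_norm_add_smul_e_le_of_le (s := 2 * ε ^ 2) hγ0
      (hsub ⟨(le_max_left _ _).trans ht.1.le, ht.2.le⟩)
      (hR t ⟨by linarith, ht.2.le⟩) (by positivity) (by nlinarith)
    linarith
  have hcont : ∀ i, Tendsto (fun t => q t i a) (𝓝[≤] T) (𝓝 (q T i a)) := by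
    intro i
    have h := (hq.continuousOn i T hTT).tendsto
    rw [nhdsWithin_Icc_eq_nhdsLE hT] at h
    exact ((EuclideanSpace.proj a : Space →L[ℝ] ℝ).continuous.tendsto _).comp h
  have hIcc : ∀ᶠ t in 𝓝[≤] T, t ∈ Icc 0 T := Icc_mem_nhdsLE hT
  obtain ⟨i, hi⟩ := hne
  have hi' := hi
  simp only [Finset.mem_sdiff, Finset.mem_insert, Finset.mem_singleton, not_or] at hi'
  obtain ⟨hiI, hij, hik⟩ := hi'
  rw [hI, Finset.mem_union] at hi
  rcases hi with h | h
  · refine ⟨k, hk, i, hiI, Ne.symm hik, key k hk i hiI (Ne.symm hik) ?_ fun ε t hεt => ?_⟩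
    · filter_upwards [hIcc, (hcont k).eventually_const_le (u := q T k a - γ) (by linarith)]
        with t ht h1
      rw [PiLp.sub_apply]
      linarith [hsep.outer_left t ht i h]
    · simp [shift, hij, hik, h, hjk.symm, push_of_ge hεt]; ring
  · have h' : i ∉ I₀ := Finset.disjoint_right.1 hdisj h
    refine ⟨i, hiI, j, hj, hij, key i hiI j hj hij ?_ fun ε t hεt => ?_⟩
    · filter_upwards [hIcc, (hcont j).eventually_le_const (u := q T j a + γ) (by linarith)]
        with t ht h1
      rw [PiLp.sub_apply]
      linarith [hsep.outer_right t ht i h]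
    · simp [shift, hij, hik, h, h', push_of_ge hεt]; ring

namespace IsBinaryCollisionSolution

theorem hasFiniteAction (hq : IsBinaryCollisionSolution m T j k q) (hm : ∀ i, 0 < m i)
    (hT : 0 < T) (I : Finset (Fin N)) : HasFiniteAction m I T q :=
  hasFiniteAction_of_le hm I hT (fun i => (hq.continuousOn i).mono Ioo_subset_Icc_self)
    ((hq.intervalIntegrable_kinetic hm hT).add (hq.intervalIntegrable_potential hm hT)) (ε := 0)
    fun _ _ _ => add_le_add (kinetic_le_univ hm I _) (potential_le_univ hm I _)

/-- The Lagrangians of the deformed and the original path, where the push is differentiable. -/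
theorem lagrangian_deform_sub (hq : IsBinaryCollisionSolution m T j k q) (hj : j ∈ I) (hk : k ∈ I)
    (hjk : j ≠ k) (a : Fin 3) (I₀ I₁ : Finset (Fin N)) {ε t d : ℝ} (ht : t ∈ Ioo 0 T)
    (h : HasDerivAt (push ε) d t) :
    lagrangian m I (deform a ε j k I₀ I₁ q) t = lagrangian m I q t
      + (d * (m k * velocity q t k a - m j * velocity q t j a) + 1 / 2 * (m j + m k) * d ^ 2)
      - (potential m I (q t) - potential m I (deform a ε j k I₀ I₁ q t)) := by
  have h1 : velocity (deform a ε j k I₀ I₁ q) t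
      = fun i => velocity q t i + shiftDeriv j k d i • e a :=
    funext fun i => velocity_deform hq a I₀ I₁ ht h i
  unfold lagrangian
  rw [h1, kinetic_add_shiftDeriv m hj hk hjk]
  ring

theorem potential_deform_le (hq : IsBinaryCollisionSolution m T j k q) (hm : ∀ i, 0 < m i)
    (hsep : IsSeparated a T j k I₀ I₁ q)
    (hI : I \ {j, k} = I₀ ∪ I₁) (hdisj : Disjoint I₀ I₁) (hjk : j ≠ k) (ε : ℝ) {t : ℝ}
    (ht : t ∈ Ioo 0 T) {i l : Fin N} (hi : i ∈ I) (hl : l ∈ I) (hil : i ≠ l) :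
    m i * m l * (‖q t i - q t l‖⁻¹
        - ‖deform a ε j k I₀ I₁ q t i - deform a ε j k I₀ I₁ q t l‖⁻¹)
      ≤ potential m I (q t) - potential m I (deform a ε j k I₀ I₁ q t) :=
  potential_deform_gain hm (hq.collision_free t ht)
    (fun _ hb _ hc _ =>
      hsep.norm_sub_le_deform hI hdisj hjk ε (Ioo_subset_Icc_self ht) hb hc) hi hl hil

theorem potential_deform_sub_nonneg (hq : IsBinaryCollisionSolution m T j k q)
    (hm : ∀ i, 0 < m i) (hsep : IsSeparated a T j k I₀ I₁ q)
    (hI : I \ {j, k} = I₀ ∪ I₁) (hdisj : Disjoint I₀ I₁) (hjk : j ≠ k) (hj : j ∈ I) (hk : k ∈ I)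
    (ε : ℝ) {t : ℝ} (ht : t ∈ Ioo 0 T) :
    0 ≤ potential m I (q t) - potential m I (deform a ε j k I₀ I₁ q t) := by
  refine le_trans (mul_nonneg (mul_nonneg (hm k).le (hm j).le) (sub_nonneg.2 ?_))
    (hq.potential_deform_le hm hsep hI hdisj hjk ε ht hk hj hjk.symm)
  exact inv_anti₀ (norm_pos_iff.2 (hq.sub_ne_zero ht hjk.symm))
    (hsep.norm_sub_le_deform hI hdisj hjk ε (Ioo_subset_Icc_self ht) hk hj)

/-- Young's inequality for each of the two masses; it dominates the cross term of the deformed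
kinetic energy by an integrable function. -/
theorem mul_coord_sub_le (hm : ∀ i, 0 < m i) (v : Fin N → Space) (j k : Fin N) (a : Fin 3)
    (d : ℝ) : d * (m k * v k a - m j * v j a)
      ≤ 2 * kinetic m Finset.univ v + 1 / 2 * (m j + m k) * d ^ 2 := by
  have h : ∀ i, m i * (v i a) ^ 2 ≤ 2 * kinetic m Finset.univ v := by
    intro i
    have h1 := norm_velocity_sq_le hm v i
    have hi := hm i
    rw [div_mul_eq_mul_div, le_div_iff₀ hi] at h1
    have h2 : (v i a) ^ 2 ≤ ‖v i‖ ^ 2 :=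
      sq_le_sq' (by linarith [neg_abs_le (v i a), IsPerturbedCollision.abs_coord_le (v i) a])
        ((le_abs_self _).trans (IsPerturbedCollision.abs_coord_le (v i) a))
    nlinarith
  have hj := mul_nonneg (hm j).le (sq_nonneg (v j a + d))
  have hk := mul_nonneg (hm k).le (sq_nonneg (v k a - d))
  nlinarith [h j, h k]

theorem hasFiniteAction_deform (hq : IsBinaryCollisionSolution m T j k q) (hm : ∀ i, 0 < m i)
    (hT : 0 < T) (hsep : IsSeparated a T j k I₀ I₁ q)
    (hI : I \ {j, k} = I₀ ∪ I₁) (hdisj : Disjoint I₀ I₁) (hjk : j ≠ k) (hj : j ∈ I) (hk : k ∈ I)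
    {ε : ℝ} (hε : 0 < ε) : HasFiniteAction m I T (deform a ε j k I₀ I₁ q) := by
  have hmj := hm j
  have hmk := hm k
  have hg : IntervalIntegrable (fun t => lagrangian m I q t
      + (2 * kinetic m Finset.univ (velocity q t) + (m j + m k) * (2 * ε) ^ 2)) volume 0 T :=
    (hq.hasFiniteAction hm hT I).add
      (((hq.intervalIntegrable_kinetic hm hT).const_mul 2).add intervalIntegrable_const)
  refine hasFiniteAction_of_le hm I hT (fun i => ?_) hg (ε := ε) fun t ht hne => ?_
  · simp only [deform_apply]
    exact ((hq.continuousOn i).mono Ioo_subset_Icc_self).add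
      ((continuous_shift ε j k I₀ I₁ i).smul continuous_const).continuousOn
  · obtain ⟨d, hd, hd2⟩ : ∃ d, HasDerivAt (push ε) d t ∧ d ^ 2 ≤ (2 * ε) ^ 2 := by
      rcases lt_or_gt_of_ne hne with h | h
      · exact ⟨_, hasDerivAt_push_of_lt h, pow_le_pow_left₀ (by linarith) (by linarith [ht.1]) 2⟩
      · exact ⟨_, hasDerivAt_push_of_gt h, by rw [zero_pow two_ne_zero]; positivity⟩
    rw [hq.lagrangian_deform_sub hj hk hjk a I₀ I₁ ht hd]
    have h1 := mul_coord_sub_le hm (velocity q t) j k a d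
    have h2 := hq.potential_deform_sub_nonneg hm hsep hI hdisj hjk hj hk ε ht
    have h3 : (m j + m k) * d ^ 2 ≤ (m j + m k) * (2 * ε) ^ 2 := by gcongr
    linarith

/-- The deformation gains from the pair `j`, `k` at least what Newton's equations predict at
first order. -/
theorem lagrangian_deform_sub_le (hq : IsBinaryCollisionSolution m T j k q) (hm : ∀ i, 0 < m i)
    (hsep : IsSeparated a T j k I₀ I₁ q)
    (hI : I \ {j, k} = I₀ ∪ I₁) (hdisj : Disjoint I₀ I₁) (hjk : j ≠ k) (hj : j ∈ I) (hk : k ∈ I)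
    {ε C t : ℝ} (hε8 : ε ≤ 1 / 8) (hC : 0 ≤ C) (ht : t ∈ Ioo 0 T) (htε : t < ε)
    (hA : -C ≤ m k * accel m (q t) k a - m j * accel m (q t) j a
        + 2 * (m j * m k) * (‖q t k - q t j‖⁻¹ ^ 3 * (q t k a - q t j a)))
    (hr : t ≤ ‖q t k - q t j‖) (hx : (q t k a - q t j a) / ‖q t k - q t j‖ ≤ 1 / 4) :
    lagrangian m I (deform a ε j k I₀ I₁ q) t - lagrangian m I q t
      ≤ (2 * (ε - t) * (m k * velocity q t k a - m j * velocity q t j a)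
          + push ε t * (m k * accel m (q t) k a - m j * accel m (q t) j a))
        + (C + 2 * (m j + m k)) * ε ^ 2 := by
  have hmj := hm j
  have hmk := hm k
  have hp0 := push_nonneg (ε := ε) ht.1.le
  have hp1 := push_le ε t
  have hne := hq.sub_ne_zero ht hjk.symm
  have hr0 := norm_pos_iff.2 hne
  have hp2 : push ε t ≤ ‖q t k - q t j‖ / 4 := by
    rw [push_of_le htε.le]
    have ht0 := ht.1
    have : t * (2 * ε - t) ≤ t * (1 / 4) := mul_le_mul_of_nonneg_left (by linarith) ht0.le
    linarith
  have htI := Ioo_subset_Icc_self ht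
  have hx0 : 0 ≤ (q t k - q t j) a := by
    rw [PiLp.sub_apply]
    linarith [(hsep.left t htI).2, (hsep.right t htI).1, hsep.eq_zero]
  rw [div_le_iff₀ hr0] at hx
  have hgain := inv_norm_add_smul_e_le hne hp0 hp2 hx0 (by rw [PiLp.sub_apply]; linarith)
  have hpot := hq.potential_deform_le hm hsep hI hdisj hjk ε ht hk hj hjk.symm
  have hdef : deform a ε j k I₀ I₁ q t k - deform a ε j k I₀ I₁ q t j
      = (q t k - q t j) + (2 * push ε t) • e a := by
    rw [deform_apply, deform_apply, add_sub_add_comm, ← sub_smul]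
    congr 2
    simp [shift, hjk.symm]
    ring
  rw [hdef] at hpot
  rw [hq.lagrangian_deform_sub hj hk hjk a I₀ I₁ ht (hasDerivAt_push_of_lt htε)]
  rw [PiLp.sub_apply] at hgain
  set X := ‖q t k - q t j‖⁻¹ ^ 3 * (q t k a - q t j a)
  set A := m k * accel m (q t) k a - m j * accel m (q t) j a
  have h1 : m k * m j * (2 * push ε t * X)
      ≤ potential m I (q t) - potential m I (deform a ε j k I₀ I₁ q t) :=
    (mul_le_mul_of_nonneg_left (by linarith) (by positivity)).trans hpot
  have h2 : 0 ≤ push ε t * (A + 2 * (m j * m k) * X + C) := mul_nonneg hp0 (by linarith)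
  have h3 : push ε t * C ≤ ε ^ 2 * C := mul_le_mul_of_nonneg_right hp1 hC
  have h4 : (2 * (ε - t)) ^ 2 ≤ (2 * ε) ^ 2 :=
    pow_le_pow_left₀ (by linarith) (by linarith [ht.1]) 2
  have h5 : 1 / 2 * (m j + m k) * (2 * (ε - t)) ^ 2 ≤ 1 / 2 * (m j + m k) * (2 * ε) ^ 2 := by
    gcongr
  linarith

theorem exists_action_deform_lt (hq : IsBinaryCollisionSolution m T j k q) (hm : ∀ i, 0 < m i)
    (hT : 0 < T) (hI : I \ {j, k} = I₀ ∪ I₁) (hdisj : Disjoint I₀ I₁) (hjk : j ≠ k) (hj : j ∈ I)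
    (hk : k ∈ I) (hne : (I \ {j, k}).Nonempty) {φ : ℝ}
    (hφ : Tendsto (polarAngle m j k q) (𝓝[>] 0) (𝓝 φ)) (hφ' : φ = 0 ∨ φ = Real.pi)
    (ha : a ≠ 2) (hsep : IsSeparated a T j k I₀ I₁ q) (hlt : q T j a < q T k a) :
    ∃ ε₀ > 0, ∀ ε : ℝ, 0 < ε → ε < ε₀ →
      HasFiniteAction m I T q ∧ HasFiniteAction m I T (deform a ε j k I₀ I₁ q) ∧
      action m I T (deform a ε j k I₀ I₁ q) < action m I T q := by
  have hmj := hm j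
  have hmk := hm k
  obtain ⟨C, τ, hC, hτ, hτT, hA, hlow, hup, hr, hx⟩ :=
    hq.exists_local_bounds hm hT hjk hφ hφ' ha hsep
  obtain ⟨i, hi, l, hl, hil, T₁, c, hT₁, hT₁T, hc, hout⟩ :=
    hsep.exists_outer_gain hq hT hI hdisj hjk hj hk hne hlt
  set u' : ℝ → ℝ := fun t => m k * velocity q t k a - m j * velocity q t j a with hu'
  set A : ℝ → ℝ := fun t => m k * accel m (q t) k a - m j * accel m (q t) j a with hAdef
  set g := m i * m l * c * (T - T₁) with hg
  have hg0 : 0 < g := mul_pos (mul_pos (mul_pos (hm i) (hm l)) hc) (by linarith)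
  set B := C + 2 * (m j + m k) with hB
  have hB0 : 0 < B := by positivity
  obtain ⟨σ, hσ, hsub⟩ := mem_nhdsGT_iff_exists_Ioc_subset.1
    (((hup (g / 4) (by positivity)).and hr).and
      (hx.eventually_le_const (show (0 : ℝ) < 1 / 4 by norm_num)))
  have hσ0 : (0 : ℝ) < σ := hσ
  -- The bound `1 / 8` ensures `push ≤ t / 4 ≤ |ρ| / 4`. The bounds `σ` and `g / (4B)` make the
  -- boundary term and the `O(ε³)` error cost at most `g ε² / 4` each, against the gain `g ε²`.
  refine ⟨min (min τ σ) (min (min T₁ (1 / 8)) (g / (4 * B))), by positivity,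
    fun ε hε hεlt => ?_⟩
  obtain ⟨⟨hετ, hεσ⟩, ⟨hεT₁, hε8⟩, hεB⟩ :
      (ε < τ ∧ ε < σ) ∧ (ε < T₁ ∧ ε < 1 / 8) ∧ ε < g / (4 * B) := by
    simpa only [lt_min_iff] using hεlt
  have hfin := hq.hasFiniteAction hm hT I
  have hfin' := hq.hasFiniteAction_deform hm hT hsep hI hdisj hjk hj hk hε
  refine ⟨hfin, hfin', ?_⟩
  have hmem : ∀ t ∈ Ioc 0 ε, t ∈ Ioc 0 τ ∧ t ∈ Ioc 0 σ ∧ t ∈ Ioo 0 T := fun t ht =>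
    ⟨⟨ht.1, ht.2.trans hετ.le⟩, ⟨ht.1, ht.2.trans hεσ.le⟩, ht.1, by linarith [ht.2]⟩
  have hpd : ∀ t ∈ Ioc 0 ε, HasDerivAt u' (A t) t := fun t ht =>
    ((IsPerturbedCollision.hasDerivAt_coord
      (hq.hasDerivAt_velocity hm (hmem t ht).2.2 k) a).const_mul _).fun_sub
      ((IsPerturbedCollision.hasDerivAt_coord
        (hq.hasDerivAt_velocity hm (hmem t ht).2.2 j) a).const_mul _)
  have hpush0 : push ε 0 = 0 := by simp [push_of_le hε.le]
  -- At `0` the individual velocities may blow up, but `u'` is bounded on both sides, so the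
  -- vanishing push makes the product continuous with value `0`.
  have hcont : ContinuousOn (fun t => push ε t * u' t) (Icc 0 ε) := by
    intro t ht
    rcases ht.1.eq_or_lt with rfl | ht0
    · rw [← continuousWithinAt_sdiff_self,
        ContinuousWithinAt, Icc_sdiff_left, hpush0, zero_mul]
      have hp : Tendsto (push ε) (𝓝[Ioc 0 ε] 0) (𝓝 0) := by
        have := (continuous_push ε).tendsto 0
        rw [hpush0] at this
        exact this.mono_left nhdsWithin_le_nhds
      refine squeeze_zero_norm' (a := fun t => push ε t * (C + g / 4)) ?_
        (by simpa using hp.mul_const (C + g / 4))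
      filter_upwards [self_mem_nhdsWithin] with t ht
      have hp0 := push_nonneg (ε := ε) ht.1.le
      rw [norm_mul, Real.norm_of_nonneg hp0, Real.norm_eq_abs]
      refine mul_le_mul_of_nonneg_left (abs_le.2 ⟨?_, ?_⟩) hp0
      · linarith [hlow t (hmem t ht).1]
      · have h1 : u' t ≤ g / 4 := (hsub (hmem t ht).2.1).1.1
        linarith
    · exact ((continuous_push ε).continuousAt.mul
        (hpd t ⟨ht0, ht.2⟩).continuousAt).continuousWithinAt
  -- The term `δ' u' + δ u''` is integrated exactly, as the derivative of `δ u'`, so no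
  -- integrability of the singular acceleration is needed.
  have hmain := integral_le_of_three_bounds
    (D := fun t => lagrangian m I (deform a ε j k I₀ I₁ q) t - lagrangian m I q t)
    (h := fun t => push ε t * u' t) (h' := fun t => 2 * (ε - t) * u' t + push ε t * A t)
    (B := B * ε ^ 2) (G := m i * m l * (c * ε ^ 2)) hε hεT₁.le hT₁T (hfin'.sub hfin) hcont
    (by simp [hpush0])
    (fun t ht => (hasDerivAt_push_of_lt ht.2).fun_mul (hpd t (Ioo_subset_Ioc_self ht)))
    (fun t ht => by
      obtain ⟨h1, h2, h3⟩ := hmem t (Ioo_subset_Ioc_self ht)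
      exact hq.lagrangian_deform_sub_le hm hsep hI hdisj hjk hj hk hε8.le hC h3 ht.2 (hA t h1)
        (hsub h2).1.2 (hsub h2).2)
    (fun t ht => by
      have htT : t ∈ Ioo 0 T := ⟨hε.trans ht.1, ht.2.trans hT₁T⟩
      have h1 := hq.lagrangian_deform_sub hj hk hjk a I₀ I₁ htT (hasDerivAt_push_of_gt ht.1)
      have h2 := hq.potential_deform_sub_nonneg hm hsep hI hdisj hjk hj hk ε htT
      linarith)
    (fun t ht => by
      have htT : t ∈ Ioo 0 T := ⟨hT₁.trans ht.1, ht.2⟩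
      have h1 := hq.lagrangian_deform_sub hj hk hjk a I₀ I₁ htT
        (hasDerivAt_push_of_gt (hεT₁.trans ht.1))
      have h2 := hq.potential_deform_le hm hsep hI hdisj hjk ε htT hi hl hil
      have h3 := mul_le_mul_of_nonneg_left (hout ε hε hεT₁.le (by linarith) t ht)
        (mul_pos (hm i) (hm l)).le
      linarith)
  rw [intervalIntegral.integral_sub hfin' hfin] at hmain
  have h1 : u' ε ≤ g / 4 := (hsub (hmem ε (right_mem_Ioc.2 hε)).2.1).1.1
  have h2 : ε * B < g / 4 := by
    rw [lt_div_iff₀ (by positivity)] at hεB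
    linarith
  have h3 : push ε ε * u' ε + B * ε ^ 2 * ε - m i * m l * (c * ε ^ 2) * (T - T₁)
      = ε ^ 2 * (u' ε + ε * B - g) := by
    rw [push_of_ge le_rfl, hg]; ring
  have h4 : ε ^ 2 * (u' ε + ε * B - g) < 0 := mul_neg_of_pos_of_neg (by positivity) (by linarith)
  simp only [action]
  linarith

end IsBinaryCollisionSolution

end

end NBody

end

theorem lemma2p4 {N : ℕ} (m : Fin N → ℝ) (hm : ∀ i, 0 < m i) (T : ℝ) (hT : 0 < T)
    (j k : Fin N) (hjk : j ≠ k) (q : NBody.Path N)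
    (hq : NBody.IsBinaryCollisionSolution m T j k q)
    (I I₀ I₁ : Finset (Fin N)) (hj : j ∈ I) (hk : k ∈ I)
    (hI : I \ {j, k} = I₀ ∪ I₁) (hne : (I \ {j, k}).Nonempty) (hdisj : Disjoint I₀ I₁)
    (φ : ℝ) (hφ : Tendsto (NBody.polarAngle m j k q) (𝓝[>] 0) (𝓝 φ))
    (hφ' : φ = 0 ∨ φ = Real.pi) :
    (NBody.IsSeparated 0 T j k I₀ I₁ q → q T j 0 < q T k 0 →
      ∃ ε₀ > 0, ∀ ε : ℝ, 0 < ε → ε < ε₀ →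
        NBody.HasFiniteAction m I T q ∧
        NBody.HasFiniteAction m I T (NBody.deform 0 ε j k I₀ I₁ q) ∧
        NBody.action m I T (NBody.deform 0 ε j k I₀ I₁ q) < NBody.action m I T q) ∧
    (NBody.IsSeparated 1 T j k I₀ I₁ q → q T j 1 < q T k 1 →
      ∃ ε₀ > 0, ∀ ε : ℝ, 0 < ε → ε < ε₀ →
        NBody.HasFiniteAction m I T q ∧
        NBody.HasFiniteAction m I T (NBody.deform 1 ε j k I₀ I₁ q) ∧
        NBody.action m I T (NBody.deform 1 ε j k I₀ I₁ q) < NBody.action m I T q) :=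
  ⟨hq.exists_action_deform_lt hm hT hI hdisj hjk hj hk hne hφ hφ' (by decide),
    hq.exists_action_deform_lt hm hT hI hdisj hjk hj hk hne hφ hφ' (by decide)⟩
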